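/- \textbf{Wang sets as transducers.} A Wang set over the alphabet $V=\{0,1\}$ consists of a finite set $H$ of states and a set of transitions (tiles) $(w,e,s,n)\in H^2\times V^2$, each leading from state $w$ to state $e$, reading the letter $s$ and writing the letter $n$. For bi-infinite words $x,y\in V^{\mathbb Z}$ write $x\,\mathcal T\,y$ if some bi-infinite run of $\mathcal T$ reads $x$ and writes $y$, i.e. if there is $h:\mathbb Z\to H$ with $(h_i,h_{i+1},x_i,y_i)\in\mathcal T$ for all $i$. Two Wang sets $\mathcal T,\mathcal T'$ are \emph{equivalent} if $x\,\mathcal T\,y\Leftrightarrow x\,\mathcal T'\,y$ for all $x,y\in V^{\mathbb Z}$. The composition $\mathcal T\circ\mathcal T'$ has state set $H\times H'$ and the transitions $((w,w'),(e,e'),s,n')$ with $(w,e,s,n)\in\mathcal T$ and $(w',e',n,n')\in\mathcal T'$ for some $n$ (the output of $\mathcal T$ is the input of $\mathcal T'$). A transition labelled $u\,|\,v$ with words $|u|=|v|=k$ abbreviates a chain of $k$ letter-to-letter transitions; if $k=0$ its two end states are connected without reading or writing anything. \textbf{The family $T_n$.} Let $g(0)=1$, $g(1)=2$, $g(n+2)=g(n)+g(n+1)$.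 For $n\ge 0$ the transducer $T_n$ has, in this compact form, two states $A,F$, one transition $\alpha$ from $A$ to $F$, and five transitions $\beta,\gamma,\delta,\epsilon,\omega$ from $F$ to $A$, with the following labels. For $n$ even: $$\begin{array}{l@{:\ }r@{\ |\ }l} \alpha & 0^{g(n+2)-3} & 1^{g(n+2)-3}\\ \beta & 0^{g(n+1)+3} & (100)1^{g(n+1)}\\ \gamma & 0^{g(n+3)+3} & 1^{g(n+2)}(000)1^{g(n+1)}\\ \delta & 0^{g(n+1)}(111)0^{g(n+2)} & 1^{g(n+3)+3}\\ \epsilon & 0^{g(n+1)}(110) & 1^{g(n+1)+3}\\ \omega & 0^{g(n+3)}(110)0^{g(n+1)} & 1^{g(n+1)}(100)1^{g(n+3)} \end{array}$$ For $n$ odd: $$\begin{array}{l@{:\ }r@{\ |\ }l} \alpha & 1^{g(n+2)-3} & 0^{g(n+2)-3}\\ \beta & 1^{g(n+1)+3} & (110)0^{g(n+1)}\\ \gamma & 1^{g(n+3)+3} & 0^{g(n+2)}(111)0^{g(n+1)}\\ \delta & 1^{g(n+1)}(000)1^{g(n+2)} & 0^{g(n+3)+3}\\ \epsilon & 1^{g(n+1)}(100)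 & 0^{g(n+1)+3}\\ \omega & 1^{g(n+3)}(100)1^{g(n+1)} & 0^{g(n+1)}(110)0^{g(n+3)} \end{array}$$ \textbf{Theorem.} For every $n\ge 0$, the transducers $T_{n+3}$ and $T_{n+1}\circ T_n\circ T_{n+1}$ are equivalent. -/

import Mathlib

/-! ### Wang sets (letter-to-letter transducers) -/

/-- A Wang set over the vertical alphabet `V`: a finite type `H` of horizontal colors (the states of
the transducer) and a set of tiles (the transitions).  A tile `(w, e, s, n)` is a transition from
the state `w` to the state `e` that reads `s` and writes `n`. -/
structure WangSet (V : Type) where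
  H : Type
  finite_H : Finite H
  tiles : Set (H × H × V × V)

namespace WangSet

/-- `𝒯.Rel w w'`: the bi-infinite word `w'` is an image of the bi-infinite word `w` under `𝒯`, that
is, some bi-infinite run of `𝒯` reads `w` and writes `w'`. -/
def Rel {V : Type} (𝒯 : WangSet V) (w w' : ℤ → V) : Prop :=
  ∃ h : ℤ → 𝒯.H, ∀ i : ℤ, (h i, h (i + 1), w i, w' i) ∈ 𝒯.tiles

/-- The composition `𝒯 ∘ 𝒯'`: what `𝒯` writes is read by `𝒯'`. -/
def comp {V : Type} (𝒯 𝒯' : WangSet V) : WangSet V where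
  H := 𝒯.H × 𝒯'.H
  finite_H :=
    haveI := 𝒯.finite_H
    haveI := 𝒯'.finite_H
    inferInstance
  tiles := {t | ∃ w e : 𝒯.H, ∃ w' e' : 𝒯'.H, ∃ s n n' : V,
    (w, e, s, n) ∈ 𝒯.tiles ∧ (w', e', n, n') ∈ 𝒯'.tiles ∧ t = ((w, w'), (e, e'), s, n')}

/-- Two Wang sets are equivalent if they induce the same relation on bi-infinite words. -/
def Equivalent {V : Type} (𝒯 𝒯' : WangSet V) : Prop :=
  ∀ w w' : ℤ → V, 𝒯.Rel w w' ↔ 𝒯'.Rel w w'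

end WangSet

/-! ### Transducers in compact form -/

/-- A transducer in compact form: the transition `e` leads from `src e` to `tgt e`, reads the word
`read e` and writes the word `write e` of the same length (possibly empty). -/
structure CompactTransducer (V : Type) where
  State : Type
  Edge : Type
  finite_Edge : Finite Edge
  src : Edge → State
  tgt : Edge → State
  read : Edge → List V
  write : Edge → List V
  length_eq : ∀ e, (read e).length = (write e).length

namespace CompactTransducer

/-- `q` can be reached from `p` by transitions that read and write the empty word. -/
def EmptyReach {V : Type} (A : CompactTransducer V) : A.State → A.State → Prop :=
  Relation.ReflTransGen fun p q => ∃ e : A.Edge, A.src e = p ∧ A.tgt e = q ∧ A.read e = []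

/-- The positions of the runs of a compact transducer: `⟨e, i⟩` means that the letter of index `i` of
the transition `e` is the next one to be processed. -/
abbrev Position {V : Type} (A : CompactTransducer V) : Type :=
  Σ e : A.Edge, Fin (A.read e).length

/-- `y` can be the position that follows `x`: either the next letter of the same transition, or, after
the last letter of a transition, the first letter of a transition that can be started from there. -/
def Next {V : Type} (A : CompactTransducer V) (x y : A.Position) : Prop :=
  (x.1 = y.1 ∧ (y.2 : ℕ) = x.2 + 1) ∨
    ((x.2 : ℕ) + 1 = (A.read x.1).length ∧ (y.2 : ℕ) = 0 ∧ A.EmptyReach (A.tgt x.1) (A.src y.1))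

/-- The Wang set given by a compact transducer: every transition that reads and writes words of length
`k` is cut into `k` transitions that read and write one letter each. -/
def toWangSet {V : Type} (A : CompactTransducer V) : WangSet V where
  H := A.Position
  finite_H :=
    haveI := A.finite_Edge
    inferInstance
  tiles := {t | ∃ x y : A.Position, A.Next x y ∧
    t = (x, y, (A.read x.1).get x.2, (A.write x.1).get (x.2.cast (A.length_eq x.1)))}

end CompactTransducer

/-! ### The family `T n` -/

/-- `g n` is the `(n + 1)`-th Fibonacci number, in the numbering `1, 2, 3, 5, 8, …`. -/
def g : ℕ → ℕ
  | 0 => 1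
  | 1 => 2
  | n + 2 => g n + g (n + 1)

/-- The names of the six transitions. -/
inductive TEdge : Type
  | alpha | beta | gamma | delta | epsilon | omega
  deriving DecidableEq

instance : Finite TEdge :=
  Finite.of_surjective
    (fun i : Fin 6 => ([.alpha, .beta, .gamma, .delta, .epsilon, .omega] : List TEdge).get i)
    fun e => by
      cases e
      exacts [⟨0, rfl⟩, ⟨1, rfl⟩, ⟨2, rfl⟩, ⟨3, rfl⟩, ⟨4, rfl⟩, ⟨5, rfl⟩]

/-- The word `a^k`. -/
abbrev pow (a : Fin 2) (k : ℕ) : List (Fin 2) := List.replicate k a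

/-- The words read by the transitions of `T n`. -/
def TRead (n : ℕ) (e : TEdge) : List (Fin 2) :=
  if Even n then
    match e with
    | .alpha => pow 0 (g (n + 2) - 3)
    | .beta => pow 0 (g (n + 1) + 3)
    | .gamma => pow 0 (g (n + 3) + 3)
    | .delta => pow 0 (g (n + 1)) ++ [1, 1, 1] ++ pow 0 (g (n + 2))
    | .epsilon => pow 0 (g (n + 1)) ++ [1, 1, 0]
    | .omega => pow 0 (g (n + 3)) ++ [1, 1, 0] ++ pow 0 (g (n + 1))
  else
    match e with
    | .alpha => pow 1 (g (n + 2) - 3)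
    | .beta => pow 1 (g (n + 1) + 3)
    | .gamma => pow 1 (g (n + 3) + 3)
    | .delta => pow 1 (g (n + 1)) ++ [0, 0, 0] ++ pow 1 (g (n + 2))
    | .epsilon => pow 1 (g (n + 1)) ++ [1, 0, 0]
    | .omega => pow 1 (g (n + 3)) ++ [1, 0, 0] ++ pow 1 (g (n + 1))

/-- The words written by the transitions of `T n`. -/
def TWrite (n : ℕ) (e : TEdge) : List (Fin 2) :=
  if Even n then
    match e with
    | .alpha => pow 1 (g (n + 2) - 3)
    | .beta => [1, 0, 0] ++ pow 1 (g (n + 1))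
    | .gamma => pow 1 (g (n + 2)) ++ [0, 0, 0] ++ pow 1 (g (n + 1))
    | .delta => pow 1 (g (n + 3) + 3)
    | .epsilon => pow 1 (g (n + 1) + 3)
    | .omega => pow 1 (g (n + 1)) ++ [1, 0, 0] ++ pow 1 (g (n + 3))
  else
    match e with
    | .alpha => pow 0 (g (n + 2) - 3)
    | .beta => [1, 1, 0] ++ pow 0 (g (n + 1))
    | .gamma => pow 0 (g (n + 2)) ++ [1, 1, 1] ++ pow 0 (g (n + 1))
    | .delta => pow 0 (g (n + 3) + 3)
    | .epsilon => pow 0 (g (n + 1) + 3)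
    | .omega => pow 0 (g (n + 1)) ++ [1, 1, 0] ++ pow 0 (g (n + 3))

theorem TRead_length_eq (n : ℕ) (e : TEdge) : (TRead n e).length = (TWrite n e).length := by
  have h : g (n + 3) = g (n + 1) + g (n + 2) := rfl
  by_cases hn : Even n <;> cases e <;> simp [TRead, TWrite, hn, h] <;> omega

/-- The transducer `T n` in compact form: `alpha` leads from state `0` to state `1`, and the five other
transitions lead from state `1` to state `0`. -/
def TCompact (n : ℕ) : CompactTransducer (Fin 2) where
  State := Fin 2
  Edge := TEdge
  finite_Edge := inferInstance
  src e := if e = .alpha then 0 else 1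
  tgt e := if e = .alpha then 1 else 0
  read := TRead n
  write := TWrite n
  length_eq := TRead_length_eq n

/-- The transducer `T n`, as a Wang set. -/
def T (n : ℕ) : WangSet (Fin 2) := (TCompact n).toWangSet

/-! A round trip in `T n`, that is one of `beta`, …, `omega` followed by `alpha`, is a block. With
`a = g (n + 1)` and `b = g (n + 2)` a run is a tiling of `ℤ` by blocks `B`, `C`, `D`, `E`, `W` of
lengths `a + b`, `a + 2b`, `a + 2b`, `a + b`, `2a + 2b`. The words read and written are constant up
to isolated marks: `D` reads a three-letter mark, `E` and `W` a two-letter one; `C` writes a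
three-letter mark, `B` and `W` a two-letter one. A block is placed three letters after its first
letter, so that marks, recorded by their ends, sit at the offsets `0`, `a`, `b`, `a + b`. Marks can
be recovered from the word (`Ink.marks_eq`), hence composing transducers amounts to matching marks
(`T_rel_iff_tiling`).

The parameters are `(a, b)` for `T n`, `(b, a + b)` for `T (n + 1)` and `(a + 2b, 2a + 3b)` for `T
(n + 3)`. It remains to compare tilings by the long blocks of `T (n + 3)` with stacks of three
tilings `U`, `M`, `L` whose inner marks agree.

From a long tiling to a stack (`exists_stack`): each long block is replaced in each layer by a word
of the same total length. The words are chosen so that the inner marks match and the outer marks are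
those of the long block.

From a stack to a long tiling (`Stack.exists_merged`): in a stack no layer contains `W`. Therefore
the blocks `D`, `E` of `M` correspond one to one to the blocks `C`, `B` of `U`, and the blocks `B`,
`C` of `M` to the blocks `E`, `D` of `L`. Small gaps between blocks of `U` or of `L` take only a few
values, which leaves few successions in `M`. Cutting `M` wherever `C` is followed by `D` gives
exactly the words `DEC`, `DBDEC`, `DBCEC`, `DBC`, `DBDCEC` of `middle`; the rest of `U` and `L` is
then forced. -/

/-! ### Tilings of the integers by five kinds of blocks -/

/-- The five round trips of a run: `beta`, …, `omega`, each followed by `alpha`. -/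
inductive Block : Type
  | B | C | D | E | W

/-- The length of a block. -/
def Block.len (a b : ℤ) : Block → ℤ
  | B => a + b
  | C => a + 2 * b
  | D => a + 2 * b
  | E => a + b
  | W => 2 * a + 2 * b

/-- `S X p` says that a block of kind `X` is placed at `p`; the blocks tile `ℤ`. -/
structure Tiling (a b : ℤ) (S : Block → ℤ → Prop) : Prop where
  next : ∀ {X p}, S X p → ∃ Y, S Y (p + X.len a b)
  disj : ∀ {X Y p q}, S X p → S Y q → p ≤ q → q < p + X.len a b → p = q ∧ X = Y
  below : ∀ p, ∃ q ≤ p, ∃ X, S X q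

theorem Block.le_len {a b : ℤ} (ha : 0 < a) (hb : 0 < b) (X : Block) : a + b ≤ X.len a b := by
  cases X <;> simp only [Block.len] <;> omega

namespace Tiling

variable {a b : ℤ} {S S' : Block → ℤ → Prop} {X Y : Block} {p q : ℤ}

theorem cover (h : Tiling a b S) (ha : 0 < a) (hb : 0 < b) (p : ℤ) :
    ∃ X q, S X q ∧ q ≤ p ∧ p < q + X.len a b := by
  obtain ⟨q, hq, X, hX⟩ := h.below p
  generalize hk : (p - q).toNat = k
  induction k using Nat.strong_induction_on generalizing q X with
  | _ k ih =>
    by_cases hlt : p < q + X.len a b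
    · exact ⟨X, q, hX, hq, hlt⟩
    · obtain ⟨Y, hY⟩ := h.next hX
      have := X.le_len ha hb
      exact ih (p - (q + X.len a b)).toNat (by omega) _ (by omega) Y hY rfl

theorem prev (h : Tiling a b S) (ha : 0 < a) (hb : 0 < b) (hY : S Y p) :
    ∃ X, S X (p - X.len a b) := by
  obtain ⟨X, q, hX, h1, h2⟩ := h.cover ha hb (p - 1)
  refine ⟨X, ?_⟩
  by_cases hlt : p < q + X.len a b
  · have := (h.disj hX hY (by omega) hlt).1
    omega
  · rwa [show p - X.len a b = q by omega]

theorem unique (h : Tiling a b S) (ha : 0 < a) (hb : 0 < b) (hX : S X p) (hY : S Y p) : X = Y :=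
  (h.disj hX hY le_rfl (by have := X.le_len ha hb; omega)).2

theorem sep (h : Tiling a b S) (hX : S X p) (hY : S Y q) :
    p = q ∧ X = Y ∨ q + Y.len a b ≤ p ∨ p + X.len a b ≤ q := by
  by_contra! hc
  rcases le_total p q with hpq | hpq
  · exact hc.1 (h.disj hX hY hpq (by omega)).1 (h.disj hX hY hpq (by omega)).2
  · have := h.disj hY hX hpq (by omega)
    exact hc.1 this.1.symm this.2.symm

/-- The possible small distances between the end of a block and the start of another one. -/
theorem lat (h : Tiling a b S) (ha : 0 < a) (hb : 0 < b) (hX : S X p) (hY : S Y q) :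
    p = q ∧ X = Y ∨ q + Y.len a b ≤ p ∨ q = p + X.len a b ∨ q = p + X.len a b + (a + b) ∨
      q = p + X.len a b + (a + 2 * b) ∨ p + X.len a b + 2 * (a + b) ≤ q := by
  rcases h.sep hX hY with h1 | h1 | h1
  · exact Or.inl h1
  · exact Or.inr (Or.inl h1)
  -- A gap shorter than `2 * (a + b)` holds at most one block, and that block is not `W`.
  obtain ⟨Z, hZ⟩ := h.next hX
  obtain ⟨Z', hZ'⟩ := h.next hZ
  have hl := Y.le_len ha hb
  have hl' := Z.le_len ha hb
  have hl'' := Z'.le_len ha hb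
  have h2 := h.sep hZ hY
  have h3 := h.sep hZ' hY
  cases Z <;> simp only [Block.len] at * <;> omega

/-- Tilings are maximal: the block of `S` that covers the place of a block of `S'` belongs to `S'`
as well, so the two coincide. -/
theorem eq_of_le (h : Tiling a b S) (h' : Tiling a b S') (ha : 0 < a) (hb : 0 < b)
    (hle : ∀ X p, S X p → S' X p) : S = S' := by
  funext X p
  refine propext ⟨hle X p, fun hX => ?_⟩
  obtain ⟨Y, q, hY, h1, h2⟩ := h.cover ha hb p
  obtain ⟨rfl, rfl⟩ := h'.disj (hle _ _ hY) hX h1 h2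
  exact hY

end Tiling

/-! ### Substitutions -/

/-- `Occ a b l p Y q`: when the word `l` is placed at `p`, it has a block `Y` at `q`. -/
def Occ (a b : ℤ) : List Block → ℤ → Block → ℤ → Prop
  | [], _, _, _ => False
  | X :: l, p, Y, q => X = Y ∧ p = q ∨ Occ a b l (p + X.len a b) Y q

/-- The length of a word of blocks. -/
def wordLen (a b : ℤ) : List Block → ℤ
  | [] => 0
  | X :: l => X.len a b + wordLen a b l

/-- The placement obtained by replacing each block `X` at `o` by the word `σ X` at `o + s`. -/
def Subst (a b : ℤ) (σ : Block → List Block) (s : ℤ) (S : Block → ℤ → Prop) (Y : Block) (q : ℤ) :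
    Prop :=
  ∃ X o, S X o ∧ Occ a b (σ X) (o + s) Y q

section Occ

variable {a b : ℤ} {l : List Block} {p q r : ℤ} {Y Z : Block}

theorem wordLen_nonneg (ha : 0 < a) (hb : 0 < b) (l : List Block) : 0 ≤ wordLen a b l := by
  induction l with
  | nil => exact le_rfl
  | cons X l ih =>
    have := X.le_len ha hb
    simp only [wordLen]
    omega

theorem Occ.bounds (ha : 0 < a) (hb : 0 < b) (h : Occ a b l p Y q) :
    p ≤ q ∧ q + Y.len a b ≤ p + wordLen a b l := by
  induction l generalizing p with
  | nil => exact h.elim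
  | cons X l ih =>
    have hl := wordLen_nonneg ha hb l
    have hX := X.le_len ha hb
    rcases h with ⟨rfl, rfl⟩ | h
    · simp only [wordLen]
      omega
    · have := ih h
      simp only [wordLen]
      omega

theorem Occ.head (h : 0 < wordLen a b l) (p : ℤ) : ∃ Y, Occ a b l p Y p := by
  cases l with
  | nil => exact absurd h (lt_irrefl _)
  | cons X l => exact ⟨X, Or.inl ⟨rfl, rfl⟩⟩

theorem Occ.next (h : Occ a b l p Y q) :
    (∃ Z, Occ a b l p Z (q + Y.len a b)) ∨ q + Y.len a b = p + wordLen a b l := by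
  induction l generalizing p with
  | nil => exact h.elim
  | cons X l ih =>
    rcases h with ⟨rfl, rfl⟩ | h
    · cases l with
      | nil => exact Or.inr (by simp [wordLen])
      | cons Z l => exact Or.inl ⟨Z, Or.inr (Or.inl ⟨rfl, rfl⟩)⟩
    · rcases ih h with ⟨Z, hZ⟩ | h
      · exact Or.inl ⟨Z, Or.inr hZ⟩
      · exact Or.inr (by rw [h, wordLen, add_assoc])

theorem Occ.disj (ha : 0 < a) (hb : 0 < b) (h : Occ a b l p Y q) (h' : Occ a b l p Z r)
    (hqr : q ≤ r) (hr : r < q + Y.len a b) : q = r ∧ Y = Z := by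
  induction l generalizing p with
  | nil => exact h.elim
  | cons X l ih =>
    have hX := X.le_len ha hb
    rcases h with ⟨rfl, rfl⟩ | h <;> rcases h' with ⟨rfl, rfl⟩ | h'
    · exact ⟨rfl, rfl⟩
    · have := h'.bounds ha hb
      omega
    · have := h.bounds ha hb
      omega
    · exact ih h h'

end Occ

/-- Since a word is as long as the block it replaces, the words of neighbouring blocks abut,
whatever the common shift `s`. -/
theorem Tiling.subst {A B a b : ℤ} {S : Block → ℤ → Prop} (h : Tiling A B S) (hA : 0 < A)
    (hB : 0 < B) (ha : 0 < a) (hb : 0 < b) {σ : Block → List Block} (s : ℤ)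
    (hσ : ∀ X, wordLen a b (σ X) = X.len A B) : Tiling a b (Subst a b σ s S) where
  next := by
    rintro Y q ⟨X, o, hX, hY⟩
    rcases hY.next with ⟨Z, hZ⟩ | hq
    · exact ⟨Z, X, o, hX, hZ⟩
    · obtain ⟨X', hX'⟩ := h.next hX
      have := X'.le_len hA hB
      obtain ⟨Z, hZ⟩ := Occ.head (a := a) (b := b) (l := σ X') (by rw [hσ]; omega)
        (o + X.len A B + s)
      refine ⟨Z, X', _, hX', ?_⟩
      rwa [hq, hσ, show o + s + X.len A B = o + X.len A B + s by ring]
  disj := by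
    rintro Y Z q r ⟨X, o, hX, hY⟩ ⟨X', o', hX', hZ⟩ hqr hr
    have h1 := hY.bounds ha hb
    have h2 := hZ.bounds ha hb
    have h3 := Z.le_len ha hb
    rw [hσ] at h1 h2
    rcases h.sep hX hX' with ⟨rfl, rfl⟩ | hs | hs
    · exact hY.disj ha hb hZ hqr hr
    · omega
    · omega
  below := by
    intro p
    obtain ⟨o, ho, X, hX⟩ := h.below (p - s)
    have := X.le_len hA hB
    obtain ⟨Z, hZ⟩ := Occ.head (a := a) (b := b) (l := σ X) (by rw [hσ]; omega) (o + s)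
    exact ⟨o + s, by omega, Z, X, o, hX, hZ⟩

/-! ### Marks -/

/-- The ends of the two-letter marks in the input. -/
def in2 (a b : ℤ) (S : Block → ℤ → Prop) (p : ℤ) : Prop := S .E (p - a) ∨ S .W (p - (a + b))

/-- The ends of the three-letter marks in the input. -/
def in3 (a : ℤ) (S : Block → ℤ → Prop) (p : ℤ) : Prop := S .D (p - a)

/-- The ends of the two-letter marks in the output. -/
def out2 (a : ℤ) (S : Block → ℤ → Prop) (p : ℤ) : Prop := S .B p ∨ S .W (p - a)

/-- The ends of the three-letter marks in the output. -/
def out3 (b : ℤ) (S : Block → ℤ → Prop) (p : ℤ) : Prop := S .C (p - b)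

/-! ### The substitutions for the three layers -/

/-- The blocks of the first transducer that replace a block of the composition. -/
def upper : Block → List Block
  | .B => [.C, .B]
  | .C => [.C, .C, .B]
  | .D => [.C, .D, .B]
  | .E => [.C, .E]
  | .W => [.C, .C, .E, .B]

/-- The blocks of the second transducer that replace a block of the composition. -/
def middle : Block → List Block
  | .B => [.D, .E, .C]
  | .C => [.D, .B, .D, .E, .C]
  | .D => [.D, .B, .C, .E, .C]
  | .E => [.D, .B, .C]
  | .W => [.D, .B, .D, .C, .E, .C]

/-- The blocks of the third transducer that replace a block of the composition. -/
def lower : Block → List Block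
  | .B => [.B, .D]
  | .C => [.E, .C, .D]
  | .D => [.E, .D, .D]
  | .E => [.E, .D]
  | .W => [.E, .B, .D, .D]

section

variable (a b : ℤ)

theorem wordLen_upper (X : Block) :
    wordLen b (a + b) (upper X) = X.len (a + 2 * b) (2 * a + 3 * b) := by
  cases X <;> simp only [upper, wordLen, Block.len] <;> ring

theorem wordLen_middle (X : Block) :
    wordLen a b (middle X) = X.len (a + 2 * b) (2 * a + 3 * b) := by
  cases X <;> simp only [middle, wordLen, Block.len] <;> ring

theorem wordLen_lower (X : Block) :
    wordLen b (a + b) (lower X) = X.len (a + 2 * b) (2 * a + 3 * b) := by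
  cases X <;> simp only [lower, wordLen, Block.len] <;> ring

variable (S : Block → ℤ → Prop)

/-- The first layer. -/
def upperLayer : Block → ℤ → Prop := Subst b (a + b) upper (-(a + 2 * b)) S

/-- The second layer. -/
def middleLayer : Block → ℤ → Prop := Subst a b middle (-(a + b)) S

/-- The third layer. -/
def lowerLayer : Block → ℤ → Prop := Subst b (a + b) lower 0 S

theorem exists_block {P : Block → Prop} : (∃ X, P X) ↔ P .B ∨ P .C ∨ P .D ∨ P .E ∨ P .W :=
  ⟨fun ⟨X, h⟩ => by cases X <;> simp [h], by rintro (h | h | h | h | h) <;> exact ⟨_, h⟩⟩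

/-- Eliminates the place of the substituted block, so that each mark identity below compares two
finite disjunctions, which `ring_nf` makes identical. -/
theorem exists_and_add_eq {P : ℤ → Prop} (d q : ℤ) : (∃ o, P o ∧ o + d = q) ↔ P (q - d) :=
  ⟨by rintro ⟨o, h, rfl⟩; simpa using h, fun h => ⟨q - d, h, by ring⟩⟩

variable {a b S}

/-- Outer marks: `D` occurs only in `upper .D`, and `E` only in `upper .E` and `upper .W`, at the
offsets where the long block reads its mark. Likewise `C` occurs only in `lower .C`, and `B` only in
`lower .B` and `lower .W`. -/
theorem upperLayer_in3 (p : ℤ) :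
    in3 b (upperLayer a b S) p ↔ in3 (a + 2 * b) S p := by
  simp only [in3, upperLayer, Subst, exists_block, upper, Occ, Block.len, reduceCtorEq, false_and,
    true_and, or_false, false_or, and_false, exists_false, add_assoc, exists_and_add_eq]
  ring_nf

theorem upperLayer_in2 (p : ℤ) :
    in2 b (a + b) (upperLayer a b S) p ↔ in2 (a + 2 * b) (2 * a + 3 * b) S p := by
  simp only [in2, upperLayer, Subst, exists_block, upper, Occ, Block.len, reduceCtorEq, false_and,
    true_and, or_false, false_or, and_false, exists_false, add_assoc, exists_and_add_eq]
  ring_nf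

theorem lowerLayer_out3 (p : ℤ) :
    out3 (a + b) (lowerLayer a b S) p ↔ out3 (2 * a + 3 * b) S p := by
  simp only [out3, lowerLayer, Subst, exists_block, lower, Occ, Block.len, reduceCtorEq, false_and,
    true_and, or_false, false_or, and_false, exists_false, add_assoc, exists_and_add_eq]
  ring_nf

theorem lowerLayer_out2 (p : ℤ) :
    out2 b (lowerLayer a b S) p ↔ out2 (a + 2 * b) S p := by
  simp only [out2, lowerLayer, Subst, exists_block, lower, Occ, Block.len, reduceCtorEq, false_and,
    true_and, or_false, false_or, and_false, exists_false, add_assoc, exists_and_add_eq]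
  ring_nf

/-- Inner marks: for each long block, the letters `C`, `B` of its `upper` word match the letters
`D`, `E` of its `middle` word in order, and the letters `B`, `C` of `middle` match the letters `E`,
`D` of `lower`. -/
theorem upperLayer_out3 (p : ℤ) :
    out3 (a + b) (upperLayer a b S) p ↔ in3 a (middleLayer a b S) p := by
  simp only [out3, in3, upperLayer, middleLayer, Subst, exists_block, upper, middle, Occ, Block.len,
    reduceCtorEq, false_and, true_and, or_false, false_or, add_assoc, and_or_left, exists_or,
    exists_and_add_eq]
  ring_nf

theorem upperLayer_out2 (p : ℤ) :
    out2 b (upperLayer a b S) p ↔ in2 a b (middleLayer a b S) p := by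
  simp only [out2, in2, upperLayer, middleLayer, Subst, exists_block, upper, middle, Occ, Block.len,
    reduceCtorEq, false_and, true_and, or_false, false_or, and_false, exists_false, add_assoc,
    exists_and_add_eq]
  ring_nf

theorem middleLayer_out3 (p : ℤ) :
    out3 b (middleLayer a b S) p ↔ in3 b (lowerLayer a b S) p := by
  simp only [out3, in3, lowerLayer, middleLayer, Subst, exists_block, lower, middle, Occ, Block.len,
    reduceCtorEq, false_and, true_and, or_false, false_or, add_assoc, and_or_left, exists_or,
    exists_and_add_eq]
  ring_nf

theorem middleLayer_out2 (p : ℤ) :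
    out2 a (middleLayer a b S) p ↔ in2 b (a + b) (lowerLayer a b S) p := by
  simp only [out2, in2, lowerLayer, middleLayer, Subst, exists_block, lower, middle, Occ, Block.len,
    reduceCtorEq, false_and, true_and, or_false, false_or, and_false, exists_false, add_assoc,
    exists_and_add_eq]
  ring_nf

end

/-! ### Three layers of tilings whose marks agree -/

/-- Three tilings such that what each of the first two writes is read by the following one. -/
structure Stack (a b : ℤ) (U M L : Block → ℤ → Prop) : Prop where
  pos : 0 < a
  lt : a < b
  lt_two : b < 2 * a
  tU : Tiling b (a + b) U
  tM : Tiling a b M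
  tL : Tiling b (a + b) L
  y2 : ∀ p, out2 b U p ↔ in2 a b M p
  y3 : ∀ p, out3 (a + b) U p ↔ in3 a M p
  z2 : ∀ p, out2 a M p ↔ in2 b (a + b) L p
  z3 : ∀ p, out3 b M p ↔ in3 b L p

namespace Stack

variable {a b : ℤ} {U M L : Block → ℤ → Prop} {X Y : Block} {p q t t' v : ℤ}

/-- The place and the length of the block of the first layer that writes the mark which the block `X`
of the second layer at `t` reads. -/
def WriterAt (a b t : ℤ) : Block → ℤ → ℤ → Prop
  | .B, _, _ => False
  | .C, _, _ => False
  | .D, v, l => v = t - b ∧ l = 2 * a + 3 * b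
  | .E, v, l => v = t + a ∧ l = a + 2 * b ∨ v = t + a - b ∧ l = 2 * a + 4 * b
  | .W, v, l => v = t + a + b ∧ l = a + 2 * b ∨ v = t + a ∧ l = 2 * a + 4 * b

/-- The place and the length of the block of the third layer that reads the mark which the block `X`
of the second layer at `t` writes. -/
def ReaderAt (a b t : ℤ) : Block → ℤ → ℤ → Prop
  | .B, u, l => u = t - b ∧ l = a + 2 * b ∨ u = t - (a + 2 * b) ∧ l = 2 * a + 4 * b
  | .C, u, l => u = t ∧ l = 2 * a + 3 * b
  | .D, _, _ => False
  | .E, _, _ => False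
  | .W, u, l => u = t + a - b ∧ l = a + 2 * b ∨ u = t - 2 * b ∧ l = 2 * a + 4 * b

theorem exists_writer (s : Stack a b U M L) (hX : M X t) (h : X ≠ .B ∧ X ≠ .C) :
    ∃ V v, U V v ∧ WriterAt a b t X v (V.len b (a + b)) := by
  have h2 := s.y2
  have h3 := s.y3
  simp only [out2, in2, out3, in3] at h2 h3
  cases X with
  | B => simp at h
  | C => simp at h
  | D =>
    exact ⟨.C, _, (h3 (t + a)).2 (by simpa using hX), by ring, by simp only [Block.len]; ring⟩
  | E =>
    rcases (h2 (t + a)).2 (Or.inl (by simpa using hX)) with h | h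
    · exact ⟨_, _, h, Or.inl ⟨by ring, by simp only [Block.len]; ring⟩⟩
    · exact ⟨_, _, h, Or.inr ⟨by ring, by simp only [Block.len]; ring⟩⟩
  | W =>
    rcases (h2 (t + (a + b))).2 (Or.inr (by simpa using hX)) with h | h
    · exact ⟨_, _, h, Or.inl ⟨by ring, by simp only [Block.len]; ring⟩⟩
    · exact ⟨_, _, h, Or.inr ⟨by ring, by simp only [Block.len]; ring⟩⟩

theorem exists_reader (s : Stack a b U M L) (hX : M X t) (h : X ≠ .D ∧ X ≠ .E) :
    ∃ V v, L V v ∧ ReaderAt a b t X v (V.len b (a + b)) := by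
  have h2 := s.z2
  have h3 := s.z3
  simp only [out2, in2, out3, in3] at h2 h3
  cases X with
  | D => simp at h
  | E => simp at h
  | C =>
    exact ⟨.D, _, (h3 (t + b)).1 (by simpa using hX), by ring, by simp only [Block.len]; ring⟩
  | B =>
    rcases (h2 t).1 (Or.inl hX) with h | h
    · exact ⟨_, _, h, Or.inl ⟨by ring, by simp only [Block.len]; ring⟩⟩
    · exact ⟨_, _, h, Or.inr ⟨by ring, by simp only [Block.len]; ring⟩⟩
  | W =>
    rcases (h2 (t + a)).1 (Or.inr (by simpa using hX)) with h | h
    · exact ⟨_, _, h, Or.inl ⟨by ring, by simp only [Block.len]; ring⟩⟩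
    · exact ⟨_, _, h, Or.inr ⟨by ring, by simp only [Block.len]; ring⟩⟩

/-- The possible positions of two blocks, at `v` and `v'` and of lengths `l` and `l'`, of the first or
of the third layer: the distance from the end of one of them to the other one is not arbitrary. -/
def Apart (a b v l v' l' : ℤ) : Prop :=
  v = v' ∧ l = l' ∨ v' + l' ≤ v ∨ v' = v + l ∨ v' = v + l + (a + 2 * b) ∨
    v' = v + l + (2 * a + 3 * b) ∨ v + l + 2 * (a + 2 * b) ≤ v'

theorem apart (ha : 0 < a) (hb : 0 < b) {S : Block → ℤ → Prop} (h : Tiling b (a + b) S)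
    (hX : S X p) (hY : S Y q) : Apart a b p (X.len b (a + b)) q (Y.len b (a + b)) := by
  rcases h.lat (by omega) (by omega) hX hY with ⟨rfl, rfl⟩ | h | h | h | h | h
  · exact Or.inl ⟨rfl, rfl⟩
  all_goals
    simp only [Apart]
    omega

theorem apartU (s : Stack a b U M L) (hX : U X p) (hY : U Y q) :
    Apart a b p (X.len b (a + b)) q (Y.len b (a + b)) :=
  apart s.pos (s.pos.trans s.lt) s.tU hX hY

theorem apartL (s : Stack a b U M L) (hX : L X p) (hY : L Y q) :
    Apart a b p (X.len b (a + b)) q (Y.len b (a + b)) :=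
  apart s.pos (s.pos.trans s.lt) s.tL hX hY

/-- Readers and writers are meant within the second layer: the partner of a reader lies in the first
layer, that of a writer in the third. A block `W` is both. -/
theorem apart_readers (s : Stack a b U M L) (hX : M X t) (hY : M Y t') (h : X ≠ .B ∧ X ≠ .C)
    (h' : Y ≠ .B ∧ Y ≠ .C) :
    ∃ v l v' l', WriterAt a b t X v l ∧ WriterAt a b t' Y v' l' ∧ Apart a b v l v' l' := by
  obtain ⟨V, v, hV, hv⟩ := s.exists_writer hX h
  obtain ⟨V', v', hV', hv'⟩ := s.exists_writer hY h'
  exact ⟨_, _, _, _, hv, hv', s.apartU hV hV'⟩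

theorem apart_writers (s : Stack a b U M L) (hX : M X t) (hY : M Y t') (h : X ≠ .D ∧ X ≠ .E)
    (h' : Y ≠ .D ∧ Y ≠ .E) :
    ∃ v l v' l', ReaderAt a b t X v l ∧ ReaderAt a b t' Y v' l' ∧ Apart a b v l v' l' := by
  obtain ⟨V, v, hV, hv⟩ := s.exists_reader hX h
  obtain ⟨V', v', hV', hv'⟩ := s.exists_reader hY h'
  exact ⟨_, _, _, _, hv, hv', s.apartL hV hV'⟩

/-- In each of the other three orders the two partners in the third layer would overlap without
being equal. -/
theorem adjacent_writers (s : Stack a b U M L) (hX : M X t) (hY : M Y (t + X.len a b))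
    (h : X = .B ∨ X = .C) (h' : Y = .B ∨ Y = .C) : X = .B ∧ Y = .C := by
  have hp := s.pos
  have hlt := s.lt
  obtain ⟨v, l, v', l', h1, h2, h3⟩ := s.apart_writers hX hY
    (by rcases h with rfl | rfl <;> simp) (by rcases h' with rfl | rfl <;> simp)
  rcases h with rfl | rfl <;> rcases h' with rfl | rfl <;>
    simp only [ReaderAt, Apart, Block.len, reduceCtorEq, and_false, and_true] at h1 h2 h3 ⊢ <;> omega

/-- The same overlap argument in the first layer. -/
theorem adjacent_readers (s : Stack a b U M L) (hX : M X t) (hY : M Y (t + X.len a b))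
    (h : X = .D ∨ X = .E) (h' : Y = .D ∨ Y = .E) : X = .D ∧ Y = .E := by
  have hp := s.pos
  have hlt := s.lt
  obtain ⟨v, l, v', l', h1, h2, h3⟩ := s.apart_readers hX hY
    (by rcases h with rfl | rfl <;> simp) (by rcases h' with rfl | rfl <;> simp)
  rcases h with rfl | rfl <;> rcases h' with rfl | rfl <;>
    simp only [WriterAt, Apart, Block.len, reduceCtorEq, and_false, and_true] at h1 h2 h3 ⊢ <;> omega

/-- The first-layer partner of `W` keeps readers away for so long that `W` would be followed by `C`
and a writer, or by `B`, `C` and a writer. By `adjacent_writers` no writer of these kinds can follow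
`C`. -/
theorem middle_ne_W (s : Stack a b U M L) : ¬ M .W t := by
  intro hW
  have hp := s.pos
  have hlt := s.lt
  have hlt2 := s.lt_two
  -- The four distances are those from `t` to the end of `W`, `W B`, `W C` and `W B C`.
  have key : ∀ Z d, M Z (t + d) → (d = 2 * a + 2 * b ∨ d = 3 * a + 3 * b ∨ d = 3 * a + 4 * b ∨
      d = 4 * a + 5 * b) → Z = .B ∨ Z = .C := by
    intro Z d hZ hd
    by_contra! hc
    obtain ⟨v, l, v', l', h1, h2, h3⟩ := s.apart_readers hW hZ (by simp) hc
    cases Z <;> simp only [WriterAt, Apart] at h1 h2 h3 <;> omega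
  have fin : ∀ d, M .C (t + d) → (d = 2 * a + 2 * b ∨ d = 3 * a + 3 * b) → False := by
    intro d hC hd
    obtain ⟨Z, hZ⟩ := s.tM.next hC
    have := s.adjacent_writers hC hZ (Or.inr rfl)
      (key Z _ (by rwa [← add_assoc]) (by simp only [Block.len]; omega))
    simp at this
  obtain ⟨Y, hY⟩ := s.tM.next hW
  rcases key Y _ hY (Or.inl rfl) with rfl | rfl
  · obtain ⟨Z, hZ⟩ := s.tM.next hY
    have hZ' := hZ
    simp only [Block.len, add_assoc] at hZ'
    have hk := key Z _ hZ' (by omega)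
    obtain rfl := (s.adjacent_writers hY hZ (Or.inl rfl) hk).2
    exact fin _ hZ' (by omega)
  · exact fin _ hY (Or.inl rfl)

/-- The mark of such a `W` is read by an `E` of the second layer. Going back from this `E` one meets
only writers, yet a run of adjacent writers is at most `B C`. -/
theorem upper_ne_W (s : Stack a b U M L) : ¬ U .W v := by
  intro hW
  have hp := s.pos
  have hlt := s.lt
  have hlt2 := s.lt_two
  have hE : M .E (v + b - a) := by
    have := (s.y2 (v + b)).1 (Or.inr (by simpa using hW))
    exact this.resolve_right s.middle_ne_W
  have key : ∀ k, (∃ Y, M Y (v + b - a - k)) →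
      (k = 0 ∨ k = a + b ∨ k = a + 2 * b ∨ k = 2 * a + 3 * b) →
      ∃ Z, M Z (v + b - a - k - Z.len a b) ∧ (Z = .B ∨ Z = .C) := by
    rintro k ⟨Y, hY⟩ hk
    obtain ⟨Z, hZ⟩ := s.tM.prev hp (by omega) hY
    refine ⟨Z, hZ, ?_⟩
    by_contra! hc
    obtain ⟨V, v', hV, h1⟩ := s.exists_writer hZ hc
    have h2 := s.apartU hV hW
    cases Z <;> simp only [WriterAt, Apart, Block.len] at h1 h2 <;> omega
  have adj : ∀ X Z p, M X p → M Z (p - Z.len a b) → (X = .B ∨ X = .C) → (Z = .B ∨ Z = .C) →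
      X = .C ∧ Z = .B := by
    intro X Z p hX hZ h h'
    have := s.adjacent_writers hZ (by simpa using hX) h' h
    tauto
  have fin : ∀ k, M .B (v + b - a - k) → (k = a + b ∨ k = 2 * a + 3 * b) → False := by
    intro k hB hk
    obtain ⟨Z, hZ, hZ'⟩ := key k ⟨_, hB⟩ (by omega)
    have := adj .B Z _ hB hZ (Or.inl rfl) hZ'
    simp at this
  obtain ⟨Y, hY, hY'⟩ := key 0 ⟨.E, by simpa using hE⟩ (Or.inl rfl)
  rcases hY' with rfl | rfl
  · exact fin _ (by simpa [Block.len] using hY) (Or.inl rfl)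
  · have hY' : M .C (v + b - a - (a + 2 * b)) := by simpa [Block.len] using hY
    obtain ⟨Z, hZ, hZ'⟩ := key _ ⟨_, hY'⟩ (by omega)
    obtain rfl := (adj _ Z _ hY' hZ (Or.inr rfl) hZ').2
    refine fin (2 * a + 3 * b) ?_ (Or.inr rfl)
    rwa [show v + b - a - (2 * a + 3 * b) = v + b - a - (a + 2 * b) - Block.B.len a b by
      simp only [Block.len]; ring]

/-- The mark read by such a `W` is written by a `B` of the second layer. The blocks after this `B`
would all have to be readers, yet a run of adjacent readers is at most `D E`. -/
theorem lower_ne_W (s : Stack a b U M L) : ¬ L .W v := by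
  intro hW
  have hp := s.pos
  have hlt := s.lt
  have hlt2 := s.lt_two
  have hB : M .B (v + (a + 2 * b)) := by
    have := (s.z2 (v + (b + (a + b)))).2 (Or.inr (by simpa using hW))
    rw [show v + (a + 2 * b) = v + (b + (a + b)) by ring]
    exact this.resolve_right s.middle_ne_W
  have key : ∀ Z d, M Z (v + (a + 2 * b) + d) → (d = a + b ∨ d = 2 * a + 3 * b ∨
      d = 2 * a + 2 * b ∨ d = 3 * a + 4 * b) → Z = .D ∨ Z = .E := by
    intro Z d hZ hd
    by_contra! hc
    obtain ⟨V, v', hV, h1⟩ := s.exists_reader hZ hc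
    have h2 := s.apartL hW hV
    cases Z <;> simp only [ReaderAt, Apart, Block.len] at h1 h2 <;> omega
  have fin : ∀ d, M .E (v + (a + 2 * b) + d) → (d = a + b ∨ d = 2 * a + 3 * b) → False := by
    intro d hE hd
    obtain ⟨Z, hZ⟩ := s.tM.next hE
    have := s.adjacent_readers hE hZ (Or.inr rfl)
      (key Z (d + (a + b)) (by rwa [← add_assoc]) (by omega))
    simp at this
  obtain ⟨Y, hY⟩ := s.tM.next hB
  rcases key Y _ hY (Or.inl rfl) with rfl | rfl
  · obtain ⟨Z, hZ⟩ := s.tM.next hY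
    have hZ' : M Z (v + (a + 2 * b) + (2 * a + 3 * b)) := by
      rwa [show v + (a + 2 * b) + (2 * a + 3 * b) =
        v + (a + 2 * b) + Block.B.len a b + Block.D.len a b by simp only [Block.len]; ring]
    obtain rfl := (s.adjacent_readers hY hZ (Or.inl rfl) (key Z _ hZ' (by omega))).2
    exact fin _ hZ' (Or.inr rfl)
  · exact fin _ hY (Or.inl rfl)

end Stack

/-! ### Reading the substituted words off a stack -/

/-- The blocks of the word `l`, placed at `p`, belong to `S`. -/
def Fits (a b : ℤ) (S : Block → ℤ → Prop) : List Block → ℤ → Prop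
  | [], _ => True
  | X :: l, p => S X p ∧ Fits a b S l (p + X.len a b)

theorem Fits.of_occ {a b : ℤ} {S : Block → ℤ → Prop} {l : List Block} {p q : ℤ} {Y : Block}
    (h : Fits a b S l p) (hY : Occ a b l p Y q) : S Y q := by
  induction l generalizing p with
  | nil => exact hY.elim
  | cons X l ih =>
    rcases hY with ⟨rfl, rfl⟩ | hY
    · exact h.1
    · exact ih h.2 hY

namespace Tiling

variable {a b : ℤ} {S : Block → ℤ → Prop} {X Y : Block} {p q : ℤ}

theorem fill_short (h : Tiling a b S) (ha : 0 < a) (hb : 0 < b) (hX : S X p) (hY : S Y q)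
    (hq : q = p + X.len a b + (a + b)) : S .B (p + X.len a b) ∨ S .E (p + X.len a b) := by
  obtain ⟨Z, hZ⟩ := h.next hX
  have hs := h.sep hZ hY
  have hl := Y.le_len ha hb
  cases Z
  · exact Or.inl hZ
  all_goals first | exact Or.inr hZ | (simp only [Block.len] at hs hl hq; omega)

theorem fill_long (h : Tiling a b S) (ha : 0 < a) (hb : 0 < b) (hX : S X p) (hY : S Y q)
    (hq : q = p + X.len a b + (a + 2 * b)) : S .C (p + X.len a b) ∨ S .D (p + X.len a b) := by
  obtain ⟨Z, hZ⟩ := h.next hX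
  obtain ⟨Z', hZ'⟩ := h.next hZ
  have hs := h.sep hZ hY
  have hs' := h.sep hZ' hY
  have hl := Y.le_len ha hb
  have hl' := Z'.le_len ha hb
  cases Z
  case C => exact Or.inl hZ
  case D => exact Or.inr hZ
  all_goals
    simp only [Block.len] at hs hs' hl hl' hq
    omega

end Tiling

theorem place_eq {S : Block → ℤ → Prop} {X : Block} {p q : ℤ} (h : S X p) (e : p = q) : S X q :=
  e ▸ h

namespace Stack

variable {a b : ℤ} {U M L : Block → ℤ → Prop} {X Y Z : Block} {p q t u v : ℤ}

/-- Once `W` is excluded, a mark of given size has one possible kind of writer and one possible kind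
of reader in each layer. -/
theorem D_iff (s : Stack a b U M L) : M .D t ↔ U .C (t - b) := by
  have := s.y3 (t + a)
  simp only [in3, out3] at this
  rw [show t - b = t + a - (a + b) by ring, this, add_sub_cancel_right]

theorem E_iff (s : Stack a b U M L) : M .E t ↔ U .B (t + a) := by
  have := s.y2 (t + a)
  simp only [in2, out2, s.middle_ne_W, s.upper_ne_W, or_false, add_sub_cancel_right] at this
  exact this.symm

theorem B_iff (s : Stack a b U M L) : M .B t ↔ L .E (t - b) := by
  have := s.z2 t
  simp only [in2, out2, s.middle_ne_W, s.lower_ne_W, or_false] at this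
  exact this

theorem C_iff (s : Stack a b U M L) : M .C t ↔ L .D t := by
  have := s.z3 (t + b)
  simp only [in3, out3, add_sub_cancel_right] at this
  exact this

/-- The four possible continuations of the second layer. -/
theorem step (s : Stack a b U M L) (hU : U X v) (hL : L Y u) (hM : M Z p)
    (hq : q = p + Z.len a b) :
    (M .B q ∧ Apart a b u (Y.len b (a + b)) (q - b) (a + 2 * b)) ∨
    (M .C q ∧ Apart a b u (Y.len b (a + b)) q (2 * a + 3 * b)) ∨
    (M .D q ∧ Apart a b v (X.len b (a + b)) (q - b) (2 * a + 3 * b)) ∨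
    (M .E q ∧ Apart a b v (X.len b (a + b)) (q + a) (a + 2 * b)) := by
  subst hq
  obtain ⟨N, hN⟩ := s.tM.next hM
  have eB : Block.B.len b (a + b) = a + 2 * b := by simp only [Block.len]; ring
  have eE : Block.E.len b (a + b) = a + 2 * b := by simp only [Block.len]; ring
  have eC : Block.C.len b (a + b) = 2 * a + 3 * b := by simp only [Block.len]; ring
  have eD : Block.D.len b (a + b) = 2 * a + 3 * b := by simp only [Block.len]; ring
  cases N with
  | B => exact Or.inl ⟨hN, eE ▸ s.apartL hL (s.B_iff.1 hN)⟩
  | C => exact Or.inr (Or.inl ⟨hN, eD ▸ s.apartL hL (s.C_iff.1 hN)⟩)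
  | D => exact Or.inr (Or.inr (Or.inl ⟨hN, eC ▸ s.apartU hU (s.D_iff.1 hN)⟩))
  | E => exact Or.inr (Or.inr (Or.inr ⟨hN, eB ▸ s.apartU hU (s.E_iff.1 hN)⟩))
  | W => exact (s.middle_ne_W hN).elim

theorem not_at (s : Stack a b U M L) (hX : M X p) (hY : M Y q) (hne : X ≠ Y) (h : p ≤ q)
    (h' : q < p + X.len a b) : False :=
  hne (s.tM.disj hX hY h h').2

/-- `t` is the end of a block `C` of the second layer that is followed by a block `D`. -/
def Cut (a b : ℤ) (M : Block → ℤ → Prop) (t : ℤ) : Prop := M .D t ∧ M .C (t - (a + 2 * b))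

/-- The three layers contain the words that replace the block `X`, in a piece that begins at `t`. -/
structure Pattern (a b : ℤ) (U M L : Block → ℤ → Prop) (X : Block) (t : ℤ) : Prop where
  cut : Cut a b M t
  upper : Fits b (a + b) U (upper X) (t - b)
  middle : Fits a b M (middle X) t
  lower : Fits b (a + b) L (lower X) (t + (a + b))
  cut_next : Cut a b M (t + X.len (a + 2 * b) (2 * a + 3 * b))

/-- The scheme of all the patterns: `step` and the distances in the outer layers leave one or two
successors. A gap of an outer layer has room for two kinds of block, one of which would demand a
partner in the second layer where another block already stands. -/
theorem pattern_B (s : Stack a b U M L) (h : Cut a b M t) (hE : M .E (t + (a + 2 * b))) :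
    Pattern a b U M L .B t := by
  have ha := s.pos
  have hab := s.lt
  obtain ⟨hD, hC⟩ := h
  have hU := s.D_iff.1 hD
  have hL := s.C_iff.1 hC
  have hUB := s.E_iff.1 hE
  rcases s.step hUB hL hE (q := t + (2 * a + 3 * b)) (by simp only [Block.len]; ring) with
    ⟨_, h⟩ | ⟨hC1, -⟩ | ⟨_, h⟩ | ⟨_, h⟩
  · simp only [Apart, Block.len] at h; omega
  · have hLD := s.C_iff.1 hC1
    rcases s.step hUB hLD hC1 (q := t + (3 * a + 5 * b)) (by simp only [Block.len]; ring) with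
      ⟨_, h⟩ | ⟨_, h⟩ | ⟨hD1, -⟩ | ⟨_, h⟩
    · simp only [Apart, Block.len] at h; omega
    · simp only [Apart, Block.len] at h; omega
    · have hLB : L .B (t + (a + b)) := by
        rcases s.tL.fill_short (by omega) (by omega) hL hLD (by simp only [Block.len]; ring) with
          h | h
        · exact place_eq h (by simp only [Block.len]; ring)
        · exact (s.not_at hE (s.B_iff.2 (place_eq (q := t + (a + 2 * b) - b) h
            (by simp only [Block.len]; ring))) (by simp) le_rfl
            (by simp only [Block.len]; omega)).elim
      refine ⟨⟨hD, hC⟩, ?_, ?_, ?_, ?_⟩ <;>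
        simp only [Fits, Cut, _root_.upper, _root_.middle, _root_.lower, Block.len, and_true]
      · exact ⟨hU, place_eq hUB (by ring)⟩
      · exact ⟨hD, hE, place_eq hC1 (by ring)⟩
      · exact ⟨hLB, place_eq hLD (by ring)⟩
      · exact ⟨place_eq hD1 (by ring), place_eq hC1 (by ring)⟩
    · simp only [Apart, Block.len] at h; omega
  · simp only [Apart, Block.len] at h; omega
  · simp only [Apart, Block.len] at h; omega

/-- After `D B C` comes either `D`, which closes the word, or `E`, which forces `C` and the closing
`D`. -/
theorem pattern_E_or_D (s : Stack a b U M L) (h : Cut a b M t) (hB : M .B (t + (a + 2 * b)))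
    (hC1 : M .C (t + (2 * a + 3 * b))) :
    Pattern a b U M L .E t ∨ Pattern a b U M L .D t := by
  have ha := s.pos
  have hab := s.lt
  obtain ⟨hD, hC⟩ := h
  have hU := s.D_iff.1 hD
  have hLE := s.B_iff.1 hB
  have hLD := s.C_iff.1 hC1
  rcases s.step hU hLD hC1 (q := t + (3 * a + 5 * b)) (by simp only [Block.len]; ring) with
    ⟨_, h⟩ | ⟨_, h⟩ | ⟨hD1, -⟩ | ⟨hE1, -⟩
  · simp only [Apart, Block.len] at h; omega
  · simp only [Apart, Block.len] at h; omega
  · left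
    have hUC := s.D_iff.1 hD1
    have hUE : U .E (t + (2 * a + 2 * b)) := by
      rcases s.tU.fill_short (by omega) (by omega) hU hUC (by simp only [Block.len]; ring) with
        h | h
      · exact (s.not_at hB (s.E_iff.2 (place_eq (q := t + (a + 2 * b) + a) h
          (by simp only [Block.len]; ring))) (by simp) le_rfl
          (by simp only [Block.len]; omega)).elim
      · exact place_eq h (by simp only [Block.len]; ring)
    refine ⟨⟨hD, hC⟩, ?_, ?_, ?_, ?_⟩ <;>
      simp only [Fits, Cut, _root_.upper, _root_.middle, _root_.lower, Block.len, and_true]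
    · exact ⟨hU, place_eq hUE (by ring)⟩
    · exact ⟨hD, hB, place_eq hC1 (by ring)⟩
    · exact ⟨place_eq hLE (by ring), place_eq hLD (by ring)⟩
    · exact ⟨place_eq hD1 (by ring), place_eq hC1 (by ring)⟩
  · right
    have hUB := s.E_iff.1 hE1
    rcases s.step hUB hLD hE1 (q := t + (4 * a + 6 * b)) (by simp only [Block.len]; ring) with
      ⟨_, h⟩ | ⟨hC2, -⟩ | ⟨_, h⟩ | ⟨_, h⟩
    · simp only [Apart, Block.len] at h; omega
    · have hLD2 := s.C_iff.1 hC2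
      rcases s.step hUB hLD2 hC2 (q := t + (5 * a + 8 * b)) (by simp only [Block.len]; ring) with
        ⟨_, h⟩ | ⟨_, h⟩ | ⟨hD2, -⟩ | ⟨_, h⟩
      · simp only [Apart, Block.len] at h; omega
      · simp only [Apart, Block.len] at h; omega
      · have hUD : U .D (t + (2 * a + 2 * b)) := by
          rcases s.tU.fill_long (by omega) (by omega) hU hUB (by simp only [Block.len]; ring) with
            h | h
          · exact (s.not_at hC1 (s.D_iff.2 (place_eq (q := t + (2 * a + 3 * b) - b) h
              (by simp only [Block.len]; ring))) (by simp) le_rfl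
              (by simp only [Block.len]; omega)).elim
          · exact place_eq h (by simp only [Block.len]; ring)
        refine ⟨⟨hD, hC⟩, ?_, ?_, ?_, ?_⟩ <;>
          simp only [Fits, Cut, _root_.upper, _root_.middle, _root_.lower, Block.len, and_true]
        · exact ⟨hU, place_eq hUD (by ring), place_eq hUB (by ring)⟩
        · exact ⟨hD, hB, place_eq hC1 (by ring), place_eq hE1 (by ring), place_eq hC2 (by ring)⟩
        · exact ⟨place_eq hLE (by ring), place_eq hLD (by ring), place_eq hLD2 (by ring)⟩
        · exact ⟨place_eq hD2 (by ring), place_eq hC2 (by ring)⟩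
      · simp only [Apart, Block.len] at h; omega
    · simp only [Apart, Block.len] at h; omega
    · simp only [Apart, Block.len] at h; omega

/-- After `D B D` comes either `C`, which forces `E C` and the closing `D`, or `E`, which forces `C`
and the closing `D`. -/
theorem pattern_W_or_C (s : Stack a b U M L) (h : Cut a b M t) (hB : M .B (t + (a + 2 * b)))
    (hD1 : M .D (t + (2 * a + 3 * b))) :
    Pattern a b U M L .W t ∨ Pattern a b U M L .C t := by
  have ha := s.pos
  have hab := s.lt
  obtain ⟨hD, hC⟩ := h
  have hU := s.D_iff.1 hD
  have hLE := s.B_iff.1 hB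
  have hUC := s.D_iff.1 hD1
  rcases s.step hUC hLE hD1 (q := t + (3 * a + 5 * b)) (by simp only [Block.len]; ring) with
    ⟨_, h⟩ | ⟨hC1, -⟩ | ⟨_, h⟩ | ⟨hE1, -⟩
  · simp only [Apart, Block.len] at h; omega
  · left
    have hLD := s.C_iff.1 hC1
    rcases s.step hUC hLD hC1 (q := t + (4 * a + 7 * b)) (by simp only [Block.len]; ring) with
      ⟨_, h⟩ | ⟨_, h⟩ | ⟨_, h⟩ | ⟨hE2, -⟩
    · simp only [Apart, Block.len] at h; omega
    · simp only [Apart, Block.len] at h; omega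
    · simp only [Apart, Block.len] at h; omega
    have hUB := s.E_iff.1 hE2
    rcases s.step hUB hLD hE2 (q := t + (5 * a + 8 * b)) (by simp only [Block.len]; ring) with
      ⟨_, h⟩ | ⟨hC2, -⟩ | ⟨_, h⟩ | ⟨_, h⟩
    · simp only [Apart, Block.len] at h; omega
    · have hLD2 := s.C_iff.1 hC2
      rcases s.step hUB hLD2 hC2 (q := t + (6 * a + 10 * b)) (by simp only [Block.len]; ring) with
        ⟨_, h⟩ | ⟨_, h⟩ | ⟨hD2, -⟩ | ⟨_, h⟩
      · simp only [Apart, Block.len] at h; omega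
      · simp only [Apart, Block.len] at h; omega
      · have hUE : U .E (t + (4 * a + 5 * b)) := by
          rcases s.tU.fill_short (by omega) (by omega) hUC hUB (by simp only [Block.len]; ring) with
            h | h
          · exact (s.not_at hC1 (s.E_iff.2 (place_eq (q := t + (3 * a + 5 * b) + a) h
              (by simp only [Block.len]; ring))) (by simp) le_rfl
              (by simp only [Block.len]; omega)).elim
          · exact place_eq h (by simp only [Block.len]; ring)
        have hLB : L .B (t + (2 * a + 3 * b)) := by
          rcases s.tL.fill_short (by omega) (by omega) hLE hLD (by simp only [Block.len]; ring) with
            h | h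
          · exact place_eq h (by simp only [Block.len]; ring)
          · exact (s.not_at hD1 (s.B_iff.2 (place_eq (q := t + (2 * a + 3 * b) + b - b) h
              (by simp only [Block.len]; ring))) (by simp) (by omega)
              (by simp only [Block.len]; omega)).elim
        refine ⟨⟨hD, hC⟩, ?_, ?_, ?_, ?_⟩ <;>
          simp only [Fits, Cut, _root_.upper, _root_.middle, _root_.lower, Block.len, and_true]
        · exact ⟨hU, place_eq hUC (by ring), place_eq hUE (by ring), place_eq hUB (by ring)⟩
        · exact ⟨hD, hB, place_eq hD1 (by ring), place_eq hC1 (by ring), place_eq hE2 (by ring),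
            place_eq hC2 (by ring)⟩
        · exact ⟨place_eq hLE (by ring), place_eq hLB (by ring), place_eq hLD (by ring),
            place_eq hLD2 (by ring)⟩
        · exact ⟨place_eq hD2 (by ring), place_eq hC2 (by ring)⟩
      · simp only [Apart, Block.len] at h; omega
    · simp only [Apart, Block.len] at h; omega
    · simp only [Apart, Block.len] at h; omega
  · simp only [Apart, Block.len] at h; omega
  · right
    have hUB := s.E_iff.1 hE1
    rcases s.step hUB hLE hE1 (q := t + (4 * a + 6 * b)) (by simp only [Block.len]; ring) with
      ⟨_, h⟩ | ⟨hC2, -⟩ | ⟨_, h⟩ | ⟨_, h⟩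
    · simp only [Apart, Block.len] at h; omega
    · have hLD := s.C_iff.1 hC2
      rcases s.step hUB hLD hC2 (q := t + (5 * a + 8 * b)) (by simp only [Block.len]; ring) with
        ⟨_, h⟩ | ⟨_, h⟩ | ⟨hD2, -⟩ | ⟨_, h⟩
      · simp only [Apart, Block.len] at h; omega
      · simp only [Apart, Block.len] at h; omega
      · have hLC : L .C (t + (2 * a + 3 * b)) := by
          rcases s.tL.fill_long (by omega) (by omega) hLE hLD (by simp only [Block.len]; ring) with
            h | h
          · exact place_eq h (by simp only [Block.len]; ring)
          · exact (s.not_at hD1 (s.C_iff.2 (place_eq (q := t + (2 * a + 3 * b)) h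
              (by simp only [Block.len]; ring))) (by simp) le_rfl
              (by simp only [Block.len]; omega)).elim
        refine ⟨⟨hD, hC⟩, ?_, ?_, ?_, ?_⟩ <;>
          simp only [Fits, Cut, _root_.upper, _root_.middle, _root_.lower, Block.len, and_true]
        · exact ⟨hU, place_eq hUC (by ring), place_eq hUB (by ring)⟩
        · exact ⟨hD, hB, place_eq hD1 (by ring), place_eq hE1 (by ring), place_eq hC2 (by ring)⟩
        · exact ⟨place_eq hLE (by ring), place_eq hLC (by ring), place_eq hLD (by ring)⟩
        · exact ⟨place_eq hD2 (by ring), place_eq hC2 (by ring)⟩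
      · simp only [Apart, Block.len] at h; omega
    · simp only [Apart, Block.len] at h; omega
    · simp only [Apart, Block.len] at h; omega

theorem exists_pattern (s : Stack a b U M L) (h : Cut a b M t) : ∃ X, Pattern a b U M L X t := by
  have ha := s.pos
  have hab := s.lt
  have hU := s.D_iff.1 h.1
  have hL := s.C_iff.1 h.2
  rcases s.step hU hL h.1 (q := t + (a + 2 * b)) rfl with
    ⟨hB, -⟩ | ⟨_, h'⟩ | ⟨_, h'⟩ | ⟨hE, -⟩
  · have hLE := s.B_iff.1 hB
    rcases s.step hU hLE hB (q := t + (2 * a + 3 * b)) (by simp only [Block.len]; ring) with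
      ⟨_, h'⟩ | ⟨hC, -⟩ | ⟨hD, -⟩ | ⟨_, h'⟩
    · simp only [Apart, Block.len] at h'; omega
    · exact (s.pattern_E_or_D h hB hC).elim (fun h => ⟨_, h⟩) (fun h => ⟨_, h⟩)
    · exact (s.pattern_W_or_C h hB hD).elim (fun h => ⟨_, h⟩) (fun h => ⟨_, h⟩)
    · simp only [Apart, Block.len] at h'; omega
  · simp only [Apart, Block.len] at h'; omega
  · simp only [Apart, Block.len] at h'; omega
  · exact ⟨_, s.pattern_B h hE⟩

/-! ### Every block of the second layer is soon followed by a cut -/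

/-- `E` must be followed by `C D`, because `E B C` has no continuation. Bounded waiting times show
that cuts exist arbitrarily far to the left, which the tiling by patterns needs. -/
theorem cut_after_E (s : Stack a b U M L) (hE : M .E t) : ∃ r ≤ t + 2 * (a + 2 * b), Cut a b M r := by
  have ha := s.pos
  have hab := s.lt
  have hUB := s.E_iff.1 hE
  -- Any block of the third layer will do: the distance to it is discarded in both cases where
  -- `step` provides it.
  obtain ⟨_, _, Y, hL⟩ := s.tL.below 0
  rcases s.step hUB hL hE (q := t + (a + b)) rfl with
    ⟨hB, -⟩ | ⟨hC, -⟩ | ⟨_, h⟩ | ⟨_, h⟩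
  · have hLE := s.B_iff.1 hB
    rcases s.step hUB hLE hB (q := t + (2 * a + 2 * b)) (by simp only [Block.len]; ring) with
      ⟨_, h⟩ | ⟨hC, -⟩ | ⟨_, h⟩ | ⟨_, h⟩
    · simp only [Apart, Block.len] at h; omega
    · have hLD := s.C_iff.1 hC
      rcases s.step hUB hLD hC (q := t + (3 * a + 4 * b)) (by simp only [Block.len]; ring) with
        ⟨_, h⟩ | ⟨_, h⟩ | ⟨_, h⟩ | ⟨_, h⟩ <;> simp only [Apart, Block.len] at h <;> omega
    · simp only [Apart, Block.len] at h; omega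
    · simp only [Apart, Block.len] at h; omega
  · have hLD := s.C_iff.1 hC
    rcases s.step hUB hLD hC (q := t + (2 * a + 3 * b)) (by simp only [Block.len]; ring) with
      ⟨_, h⟩ | ⟨_, h⟩ | ⟨hD, -⟩ | ⟨_, h⟩
    · simp only [Apart, Block.len] at h; omega
    · simp only [Apart, Block.len] at h; omega
    · exact ⟨_, by omega, hD, place_eq hC (by ring)⟩
    · simp only [Apart, Block.len] at h; omega
  · simp only [Apart, Block.len] at h; omega
  · simp only [Apart, Block.len] at h; omega

theorem cut_after_C (s : Stack a b U M L) (hC : M .C t) : ∃ r ≤ t + 3 * (a + 2 * b), Cut a b M r := by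
  have ha := s.pos
  have hab := s.lt
  have hLD := s.C_iff.1 hC
  obtain ⟨_, _, X, hU⟩ := s.tU.below 0
  rcases s.step hU hLD hC (q := t + (a + 2 * b)) rfl with
    ⟨_, h⟩ | ⟨_, h⟩ | ⟨hD, -⟩ | ⟨hE, -⟩
  · simp only [Apart, Block.len] at h; omega
  · simp only [Apart, Block.len] at h; omega
  · exact ⟨_, by omega, hD, place_eq hC (by ring)⟩
  · obtain ⟨r, hr, h⟩ := s.cut_after_E hE
    exact ⟨r, by omega, h⟩

theorem cut_after_B (s : Stack a b U M L) (hB : M .B t) : ∃ r ≤ t + 5 * (a + 2 * b), Cut a b M r := by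
  have ha := s.pos
  have hab := s.lt
  have hLE := s.B_iff.1 hB
  obtain ⟨_, _, X, hU⟩ := s.tU.below 0
  rcases s.step hU hLE hB (q := t + (a + b)) rfl with
    ⟨_, h⟩ | ⟨hC, -⟩ | ⟨hD, -⟩ | ⟨hE, -⟩
  · simp only [Apart, Block.len] at h; omega
  · obtain ⟨r, hr, h⟩ := s.cut_after_C hC
    exact ⟨r, by omega, h⟩
  · have hUC := s.D_iff.1 hD
    rcases s.step hUC hLE hD (q := t + (2 * a + 3 * b)) (by simp only [Block.len]; ring) with
      ⟨_, h⟩ | ⟨hC, -⟩ | ⟨_, h⟩ | ⟨hE, -⟩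
    · simp only [Apart, Block.len] at h; omega
    · obtain ⟨r, hr, h⟩ := s.cut_after_C hC
      exact ⟨r, by omega, h⟩
    · simp only [Apart, Block.len] at h; omega
    · obtain ⟨r, hr, h⟩ := s.cut_after_E hE
      exact ⟨r, by omega, h⟩
  · obtain ⟨r, hr, h⟩ := s.cut_after_E hE
    exact ⟨r, by omega, h⟩

theorem cut_after (s : Stack a b U M L) (hX : M X t) : ∃ r ≤ t + 6 * (a + 2 * b), Cut a b M r := by
  have ha := s.pos
  have hab := s.lt
  cases X with
  | B => obtain ⟨r, hr, h⟩ := s.cut_after_B hX; exact ⟨r, by omega, h⟩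
  | C => obtain ⟨r, hr, h⟩ := s.cut_after_C hX; exact ⟨r, by omega, h⟩
  | E => obtain ⟨r, hr, h⟩ := s.cut_after_E hX; exact ⟨r, by omega, h⟩
  | W => exact (s.middle_ne_W hX).elim
  | D =>
    have hUC := s.D_iff.1 hX
    obtain ⟨_, _, Y, hL⟩ := s.tL.below 0
    rcases s.step hUC hL hX (q := t + (a + 2 * b)) rfl with
      ⟨hB, -⟩ | ⟨hC, -⟩ | ⟨_, h⟩ | ⟨hE, -⟩
    · obtain ⟨r, hr, h⟩ := s.cut_after_B hB; exact ⟨r, by omega, h⟩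
    · obtain ⟨r, hr, h⟩ := s.cut_after_C hC; exact ⟨r, by omega, h⟩
    · simp only [Apart, Block.len] at h; omega
    · obtain ⟨r, hr, h⟩ := s.cut_after_E hE; exact ⟨r, by omega, h⟩

/-! ### The tiling of the composition -/

/-- The blocks of the composition. -/
def Merged (a b : ℤ) (U M L : Block → ℤ → Prop) (X : Block) (o : ℤ) : Prop :=
  Pattern a b U M L X (o - (a + b))

/-- There is no cut inside a pattern. -/
theorem Pattern.not_cut (s : Stack a b U M L) (h : Pattern a b U M L X t) (hr : Cut a b M p)
    (h1 : t < p) (h2 : p < t + X.len (a + 2 * b) (2 * a + 3 * b)) : False := by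
  have ha := s.pos
  have hab := s.lt
  have hm := h.middle
  obtain ⟨hD, hC⟩ := hr
  have sepD : ∀ {Y q}, M Y q → p + (a + 2 * b) ≤ q ∨ q + Y.len a b ≤ p ∨ q = p ∧ Y = .D := by
    intro Y q hY
    have := s.tM.sep hY hD
    simp only [Block.len] at this ⊢
    tauto
  have sepC : ∀ {Y q}, M Y q → p ≤ q ∨ q + Y.len a b ≤ p - (a + 2 * b) ∨ Y = .C := by
    intro Y q hY
    have := s.tM.sep hY hC
    simp only [Block.len, sub_add_cancel] at this ⊢
    tauto
  -- A `D` after the first letter occurs only in the words of `.C` and `.W`, and there it follows a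
  -- `B`; `sepC` confronts this `B` with the `C` of the cut.
  cases X <;> simp only [_root_.middle, Fits, and_true] at hm <;>
    simp only [Block.len] at hm h2
  · obtain ⟨h3, h4, h5⟩ := hm
    have h3 := sepD h3
    have h4 := sepD h4
    have h5 := sepD h5
    simp only [Block.len, reduceCtorEq, and_false, and_true, or_false] at h3 h4 h5
    omega
  · obtain ⟨h3, h4, h5, h6, h7⟩ := hm
    have h3 := sepD h3
    have h4' := sepC h4
    have h4 := sepD h4
    have h5 := sepD h5
    have h6 := sepD h6
    have h7 := sepD h7
    simp only [Block.len, reduceCtorEq, and_false, and_true, or_false] at h3 h4 h4' h5 h6 h7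
    omega
  · obtain ⟨h3, h4, h5, h6, h7⟩ := hm
    have h3 := sepD h3
    have h4 := sepD h4
    have h5 := sepD h5
    have h6 := sepD h6
    have h7 := sepD h7
    simp only [Block.len, reduceCtorEq, and_false, and_true, or_false] at h3 h4 h5 h6 h7
    omega
  · obtain ⟨h3, h4, h5⟩ := hm
    have h3 := sepD h3
    have h4 := sepD h4
    have h5 := sepD h5
    simp only [Block.len, reduceCtorEq, and_false, and_true, or_false] at h3 h4 h5
    omega
  · obtain ⟨h3, h4, h5, h6, h7, h8⟩ := hm
    have h3 := sepD h3
    have h4' := sepC h4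
    have h4 := sepD h4
    have h5 := sepD h5
    have h6 := sepD h6
    have h7 := sepD h7
    have h8 := sepD h8
    simp only [Block.len, reduceCtorEq, and_false, and_true, or_false] at h3 h4 h4' h5 h6 h7 h8
    omega

/-- If the lengths differ, the cut that ends the shorter pattern lies inside the longer one. If they
agree, the words `DEC` and `DBC` differ in the second letter, `DBDEC` and `DBCEC` in the third. -/
theorem Pattern.unique (s : Stack a b U M L) (hX : Pattern a b U M L X t)
    (hY : Pattern a b U M L Y t) : X = Y := by
  have ha := s.pos
  have hab := s.lt
  by_contra hne
  wlog hlt : X.len (a + 2 * b) (2 * a + 3 * b) ≤ Y.len (a + 2 * b) (2 * a + 3 * b) generalizing X Y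
  · exact this hY hX (Ne.symm hne) (le_of_not_ge hlt)
  rcases hlt.lt_or_eq with hlt | heq
  · refine hY.not_cut s hX.cut_next ?_ (by omega)
    have := X.le_len (a := a + 2 * b) (b := 2 * a + 3 * b) (by omega) (by omega)
    omega
  · have h1 := hX.middle
    have h2 := hY.middle
    have key : ∀ {X Y q}, M X q → M Y q → X = Y := s.tM.unique ha (by omega)
    cases X <;> cases Y <;> first
      | exact hne rfl
      | (simp only [Block.len] at heq; omega)
      | (cases key h1.2.1 h2.2.1; done)
      | cases key h1.2.2.1 h2.2.2.1

theorem merged_tiling (s : Stack a b U M L) :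
    Tiling (a + 2 * b) (2 * a + 3 * b) (Merged a b U M L) where
  next := by
    intro X o hX
    obtain ⟨Y, hY⟩ := s.exists_pattern hX.cut_next
    refine ⟨Y, ?_⟩
    rwa [Merged, show o + X.len (a + 2 * b) (2 * a + 3 * b) - (a + b) =
      o - (a + b) + X.len (a + 2 * b) (2 * a + 3 * b) by ring]
  disj := by
    intro X Y p q hX hY hpq hq
    rcases hpq.lt_or_eq with hlt | rfl
    · exact (Pattern.not_cut s hX hY.cut (by omega) (by omega)).elim
    · exact ⟨rfl, Pattern.unique s hX hY⟩
  below := by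
    intro p
    -- The bound of `cut_after`, plus the offset `a + b` from a cut to the place of its long block.
    obtain ⟨q, hq, X, hX⟩ := s.tM.below (p - (a + b) - 6 * (a + 2 * b))
    obtain ⟨r, hr, h⟩ := s.cut_after hX
    obtain ⟨Y, hY⟩ := s.exists_pattern h
    exact ⟨r + (a + b), by omega, Y, by rwa [Merged, add_sub_cancel_right]⟩

/-- A pattern supplies the inclusion in `U`, and an inclusion between tilings is an equality. -/
theorem upperLayer_merged (s : Stack a b U M L) : upperLayer a b (Merged a b U M L) = U := by
  have ha := s.pos
  have hab := s.lt
  refine (s.merged_tiling.subst (by omega) (by omega) (by omega) (by omega) _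
    (wordLen_upper a b)).eq_of_le s.tU (by omega) (by omega) ?_
  rintro X p ⟨Y, o, hY, h⟩
  rw [show o + -(a + 2 * b) = o - (a + b) - b by ring] at h
  exact hY.upper.of_occ h

theorem lowerLayer_merged (s : Stack a b U M L) : lowerLayer a b (Merged a b U M L) = L := by
  have ha := s.pos
  have hab := s.lt
  refine (s.merged_tiling.subst (by omega) (by omega) (by omega) (by omega) _
    (wordLen_lower a b)).eq_of_le s.tL (by omega) (by omega) ?_
  rintro X p ⟨Y, o, hY, h⟩
  rw [show o + 0 = o - (a + b) + (a + b) by ring] at h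
  exact hY.lower.of_occ h

/-- The blocks of the composition read what the first layer reads and write what the third layer
writes. -/
theorem exists_merged (s : Stack a b U M L) :
    ∃ S, Tiling (a + 2 * b) (2 * a + 3 * b) S ∧
      in2 (a + 2 * b) (2 * a + 3 * b) S = in2 b (a + b) U ∧ in3 (a + 2 * b) S = in3 b U ∧
      out2 (a + 2 * b) S = out2 b L ∧ out3 (2 * a + 3 * b) S = out3 (a + b) L := by
  refine ⟨_, s.merged_tiling, ?_, ?_, ?_, ?_⟩ <;> funext p <;> apply propext
  · rw [← upperLayer_in2, s.upperLayer_merged]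
  · rw [← upperLayer_in3, s.upperLayer_merged]
  · rw [← lowerLayer_out2, s.lowerLayer_merged]
  · rw [← lowerLayer_out3, s.lowerLayer_merged]

end Stack

/-- Every tiling by the blocks of the composition comes from three layers. -/
theorem exists_stack {a b : ℤ} {S : Block → ℤ → Prop} (ha : 0 < a) (hab : a < b) (hba : b < 2 * a)
    (h : Tiling (a + 2 * b) (2 * a + 3 * b) S) :
    ∃ U M L, Stack a b U M L ∧
      in2 b (a + b) U = in2 (a + 2 * b) (2 * a + 3 * b) S ∧ in3 b U = in3 (a + 2 * b) S ∧
      out2 b L = out2 (a + 2 * b) S ∧ out3 (a + b) L = out3 (2 * a + 3 * b) S := by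
  refine ⟨upperLayer a b S, middleLayer a b S, lowerLayer a b S, ?_, funext fun p => propext ?_,
    funext fun p => propext ?_, funext fun p => propext ?_, funext fun p => propext ?_⟩
  · exact {
      pos := ha
      lt := hab
      lt_two := hba
      tU := h.subst (by omega) (by omega) (by omega) (by omega) _ (wordLen_upper a b)
      tM := h.subst (by omega) (by omega) (by omega) (by omega) _ (wordLen_middle a b)
      tL := h.subst (by omega) (by omega) (by omega) (by omega) _ (wordLen_lower a b)
      y2 := upperLayer_out2
      y3 := upperLayer_out3
      z2 := middleLayer_out2
      z3 := middleLayer_out3 }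
  · exact upperLayer_in2 p
  · exact upperLayer_in3 p
  · exact lowerLayer_out2 p
  · exact lowerLayer_out3 p

/-! ### Words drawn from marks -/

/-- The places where the word with marks `m2` and `m3` on the background `c` differs from `c`. -/
def Dark (c : Fin 2) (m2 m3 : ℤ → Prop) (q : ℤ) : Prop :=
  m3 (q + 1) ∨ m3 (q + 2) ∨ m3 (q + 3) ∨ m2 (q + 2) ∨ m2 (if c = 0 then q + 3 else q + 1)

/-- `x` is the word with marks `m2` and `m3` on the background `c`. -/
def Ink (c : Fin 2) (m2 m3 : ℤ → Prop) (x : ℤ → Fin 2) : Prop :=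
  ∀ q, x q ≠ c ↔ Dark c m2 m3 q

theorem exists_ink (c : Fin 2) (m2 m3 : ℤ → Prop) : ∃ x, Ink c m2 m3 x := by
  classical
  refine ⟨fun q => if Dark c m2 m3 q then 1 - c else c, fun q => ?_⟩
  have hc : 1 - c ≠ c := by decide +revert
  by_cases h : Dark c m2 m3 q <;> simp [h, hc]

/-- Marks do not overlap. -/
structure Sparse (m2 m3 : ℤ → Prop) : Prop where
  not_both : ∀ p, m2 p → ¬ m3 p
  sep22 : ∀ p q, m2 p → m2 q → p < q → p + 4 ≤ q
  sep23 : ∀ p q, m2 p → m3 q → p < q → p + 4 ≤ q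
  sep32 : ∀ p q, m3 p → m2 q → p < q → p + 4 ≤ q
  sep33 : ∀ p q, m3 p → m3 q → p < q → p + 4 ≤ q

/-- Each mark occupies a window of three letters, and at least one background letter separates two
windows. Hence every maximal dark run is a single mark, and its length tells the kind. -/
theorem Sparse.m3_iff {c : Fin 2} {m2 m3 : ℤ → Prop} (h : Sparse m2 m3) (p : ℤ) :
    m3 p ↔ Dark c m2 m3 (p - 3) ∧ Dark c m2 m3 (p - 2) ∧ Dark c m2 m3 (p - 1) := by
  obtain ⟨h0, h22, h23, h32, h33⟩ := h
  simp only [Dark]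
  split_ifs <;> ring_nf <;> grind

theorem Sparse.m2_iff {c : Fin 2} {m2 m3 : ℤ → Prop} (h : Sparse m2 m3) (p : ℤ) :
    m2 p ↔ if c = 0 then
      ¬ Dark c m2 m3 (p - 4) ∧ Dark c m2 m3 (p - 3) ∧ Dark c m2 m3 (p - 2) ∧ ¬ Dark c m2 m3 (p - 1)
    else ¬ Dark c m2 m3 (p - 3) ∧ Dark c m2 m3 (p - 2) ∧ Dark c m2 m3 (p - 1) ∧
      ¬ Dark c m2 m3 p := by
  obtain ⟨h0, h22, h23, h32, h33⟩ := h
  simp only [Dark]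
  split_ifs <;> ring_nf <;> grind

theorem Ink.marks_eq {c : Fin 2} {m2 m3 m2' m3' : ℤ → Prop} {x : ℤ → Fin 2}
    (h : Ink c m2 m3 x) (h' : Ink c m2' m3' x) (hs : Sparse m2 m3) (hs' : Sparse m2' m3') :
    m2 = m2' ∧ m3 = m3' := by
  have key : Dark c m2 m3 = Dark c m2' m3' := funext fun q => propext ((h q).symm.trans (h' q))
  constructor <;> funext p <;> apply propext
  · rw [hs.m2_iff (c := c), hs'.m2_iff (c := c), key]
  · rw [hs.m3_iff (c := c), hs'.m3_iff (c := c), key]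

theorem Tiling.sparse_in {a b : ℤ} {S : Block → ℤ → Prop} (h : Tiling a b S) (ha : 2 ≤ a)
    (hb : 3 ≤ b) : Sparse (in2 a b S) (in3 a S) := by
  have key : ∀ {X Y p q}, S X p → S Y q →
      p = q ∧ X = Y ∨ q + Y.len a b ≤ p ∨ p + X.len a b ≤ q := h.sep
  refine ⟨?_, ?_, ?_, ?_, ?_⟩
  · rintro p (h | h) h' <;> have := key h h' <;>
      simp only [Block.len, reduceCtorEq, and_false, false_or] at this <;> omega
  · rintro p q (h | h) (h' | h') hlt <;> have := key h h' <;>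
      simp only [Block.len, reduceCtorEq, and_false, and_true, false_or] at this <;> omega
  · rintro p q (h | h) h' hlt <;> have := key h h' <;>
      simp only [Block.len, reduceCtorEq, and_false, false_or] at this <;> omega
  · rintro p q h (h' | h') hlt <;> have := key h h' <;>
      simp only [Block.len, reduceCtorEq, and_false, false_or] at this <;> omega
  · intro p q h h' hlt
    have := key h h'
    simp only [Block.len, and_true] at this
    omega

theorem Tiling.sparse_out {a b : ℤ} {S : Block → ℤ → Prop} (h : Tiling a b S) (ha : 2 ≤ a)
    (hb : 3 ≤ b) : Sparse (out2 a S) (out3 b S) := by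
  have key : ∀ {X Y p q}, S X p → S Y q →
      p = q ∧ X = Y ∨ q + Y.len a b ≤ p ∨ p + X.len a b ≤ q := h.sep
  refine ⟨?_, ?_, ?_, ?_, ?_⟩
  · rintro p (h | h) h' <;> have := key h h' <;>
      simp only [Block.len, reduceCtorEq, and_false, false_or] at this <;> omega
  · rintro p q (h | h) (h' | h') hlt <;> have := key h h' <;>
      simp only [Block.len, reduceCtorEq, and_false, and_true, false_or] at this <;> omega
  · rintro p q (h | h) h' hlt <;> have := key h h' <;>
      simp only [Block.len, reduceCtorEq, and_false, false_or] at this <;> omega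
  · rintro p q h (h' | h') hlt <;> have := key h h' <;>
      simp only [Block.len, reduceCtorEq, and_false, false_or] at this <;> omega
  · intro p q h h' hlt
    have := key h h'
    simp only [Block.len, and_true] at this
    omega

/-! ### The letters of a block -/

/-- Whether the letter of index `k` belongs to a two-letter mark that ends at `p + 3`. -/
def Dark2 (c : Fin 2) (p k : ℤ) : Prop :=
  if c = 0 then p ≤ k ∧ k < p + 2 else p + 1 ≤ k ∧ k < p + 3

/-- The indices of the input letters of a block that differ from the background `c`. -/
def Block.InDark (a b : ℤ) (c : Fin 2) : Block → ℤ → Prop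
  | B, _ => False
  | C, _ => False
  | D, k => a ≤ k ∧ k < a + 3
  | E, k => Dark2 c a k
  | W, k => Dark2 c (a + b) k

/-- The indices of the output letters of a block that differ from the background `c`. -/
def Block.OutDark (a b : ℤ) (c : Fin 2) : Block → ℤ → Prop
  | B, k => Dark2 c 0 k
  | C, k => b ≤ k ∧ k < b + 3
  | D, _ => False
  | E, _ => False
  | W, k => Dark2 c a k

section

variable {a b : ℤ} {S : Block → ℤ → Prop} {X : Block} {p q : ℤ}

/-- The `3` undoes the shift in the placement of blocks: the block covering `q + 3` is the one whose
letters include `q`, and its marks stay within its own letters. -/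
theorem Tiling.dark_in_iff (h : Tiling a b S) (ha : 2 ≤ a) (hb : 3 ≤ b) (c : Fin 2) (hX : S X p)
    (h1 : p ≤ q + 3) (h2 : q + 3 < p + X.len a b) :
    Dark c (in2 a b S) (in3 a S) q ↔ X.InDark a b c (q + 3 - p) := by
  have key : ∀ {Y r}, S Y r → p = r ∧ X = Y ∨ r + Y.len a b ≤ q + 3 ∨ q + 3 < r := by
    intro Y r hY
    rcases h.sep hX hY with h | h | h
    · exact Or.inl h
    · exact Or.inr (Or.inl (by omega))
    · exact Or.inr (Or.inr (by omega))
  constructor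
  · simp only [Dark, in2, in3]
    split_ifs with hc <;> rintro (h | h | h | (h | h) | (h | h)) <;>
    · rcases key h with ⟨rfl, rfl⟩ | h | h
      · simp only [Block.InDark, Dark2, hc, if_true, if_false]; omega
      · simp only [Block.len] at h; omega
      · omega
  · have mv : ∀ {Y r}, S Y p → p = r → S Y r := fun h e => e ▸ h
    simp only [Dark, in2, in3]
    cases X <;> simp only [Block.InDark, Dark2, IsEmpty.forall_iff]
    · rintro ⟨h3, h4⟩
      have : q = p - 3 + a ∨ q = p - 2 + a ∨ q = p - 1 + a := by omega
      rcases this with rfl | rfl | rfl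
      · exact Or.inr (Or.inr (Or.inl (mv hX (by ring))))
      · exact Or.inr (Or.inl (mv hX (by ring)))
      · exact Or.inl (mv hX (by ring))
    · split_ifs with hc <;> rintro ⟨h3, h4⟩
      · have : q = p - 3 + a ∨ q = p - 2 + a := by omega
        rcases this with rfl | rfl
        · exact Or.inr (Or.inr (Or.inr (Or.inr (Or.inl (mv hX (by ring))))))
        · exact Or.inr (Or.inr (Or.inr (Or.inl (Or.inl (mv hX (by ring))))))
      · have : q = p - 1 + a ∨ q = p - 2 + a := by omega
        rcases this with rfl | rfl
        · exact Or.inr (Or.inr (Or.inr (Or.inr (Or.inl (mv hX (by ring))))))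
        · exact Or.inr (Or.inr (Or.inr (Or.inl (Or.inl (mv hX (by ring))))))
    · split_ifs with hc <;> rintro ⟨h3, h4⟩
      · have : q = p - 3 + (a + b) ∨ q = p - 2 + (a + b) := by omega
        rcases this with rfl | rfl
        · exact Or.inr (Or.inr (Or.inr (Or.inr (Or.inr (mv hX (by ring))))))
        · exact Or.inr (Or.inr (Or.inr (Or.inl (Or.inr (mv hX (by ring))))))
      · have : q = p - 1 + (a + b) ∨ q = p - 2 + (a + b) := by omega
        rcases this with rfl | rfl
        · exact Or.inr (Or.inr (Or.inr (Or.inr (Or.inr (mv hX (by ring))))))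
        · exact Or.inr (Or.inr (Or.inr (Or.inl (Or.inr (mv hX (by ring))))))

theorem Tiling.dark_out_iff (h : Tiling a b S) (ha : 2 ≤ a) (hb : 3 ≤ b) (c : Fin 2) (hX : S X p)
    (h1 : p ≤ q + 3) (h2 : q + 3 < p + X.len a b) :
    Dark c (out2 a S) (out3 b S) q ↔ X.OutDark a b c (q + 3 - p) := by
  have key : ∀ {Y r}, S Y r → p = r ∧ X = Y ∨ r + Y.len a b ≤ q + 3 ∨ q + 3 < r := by
    intro Y r hY
    rcases h.sep hX hY with h | h | h
    · exact Or.inl h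
    · exact Or.inr (Or.inl (by omega))
    · exact Or.inr (Or.inr (by omega))
  constructor
  · simp only [Dark, out2, out3]
    split_ifs with hc <;> rintro (h | h | h | (h | h) | (h | h)) <;>
    · rcases key h with ⟨rfl, rfl⟩ | h | h
      · simp only [Block.OutDark, Dark2, hc, if_true, if_false]; omega
      · simp only [Block.len] at h; omega
      · omega
  · have mv : ∀ {Y r}, S Y p → p = r → S Y r := fun h e => e ▸ h
    simp only [Dark, out2, out3]
    cases X <;> simp only [Block.OutDark, Dark2, IsEmpty.forall_iff]
    · split_ifs with hc <;> rintro ⟨h3, h4⟩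
      · have : q = p - 3 ∨ q = p - 2 := by omega
        rcases this with rfl | rfl
        · exact Or.inr (Or.inr (Or.inr (Or.inr (Or.inl (mv hX (by ring))))))
        · exact Or.inr (Or.inr (Or.inr (Or.inl (Or.inl (mv hX (by ring))))))
      · have : q = p - 1 ∨ q = p - 2 := by omega
        rcases this with rfl | rfl
        · exact Or.inr (Or.inr (Or.inr (Or.inr (Or.inl (mv hX (by ring))))))
        · exact Or.inr (Or.inr (Or.inr (Or.inl (Or.inl (mv hX (by ring))))))
    · rintro ⟨h3, h4⟩
      have : q = p - 3 + b ∨ q = p - 2 + b ∨ q = p - 1 + b := by omega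
      rcases this with rfl | rfl | rfl
      · exact Or.inr (Or.inr (Or.inl (mv hX (by ring))))
      · exact Or.inr (Or.inl (mv hX (by ring)))
      · exact Or.inl (mv hX (by ring))
    · split_ifs with hc <;> rintro ⟨h3, h4⟩
      · have : q = p - 3 + a ∨ q = p - 2 + a := by omega
        rcases this with rfl | rfl
        · exact Or.inr (Or.inr (Or.inr (Or.inr (Or.inr (mv hX (by ring))))))
        · exact Or.inr (Or.inr (Or.inr (Or.inl (Or.inr (mv hX (by ring))))))
      · have : q = p - 1 + a ∨ q = p - 2 + a := by omega
        rcases this with rfl | rfl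
        · exact Or.inr (Or.inr (Or.inr (Or.inr (Or.inr (mv hX (by ring))))))
        · exact Or.inr (Or.inr (Or.inr (Or.inl (Or.inr (mv hX (by ring))))))

end

/-! ### Lengths and letters of the transitions -/

/-- The transition of a block that is not `alpha`. -/
def Block.edge : Block → TEdge
  | B => .beta
  | C => .gamma
  | D => .delta
  | E => .epsilon
  | W => .omega

theorem Block.edge_injective {X Y : Block} (h : X.edge = Y.edge) : X = Y := by
  cases X <;> cases Y <;> first | rfl | exact TEdge.noConfusion h

theorem Block.edge_ne (X : Block) : X.edge ≠ .alpha := by cases X <;> exact TEdge.noConfusion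

theorem TEdge.exists_block {e : TEdge} (h : e ≠ .alpha) : ∃ X : Block, X.edge = e := by
  cases e
  exacts [(h rfl).elim, ⟨.B, rfl⟩, ⟨.C, rfl⟩, ⟨.D, rfl⟩, ⟨.E, rfl⟩, ⟨.W, rfl⟩]

theorem two_le_g (n : ℕ) : 2 ≤ g (n + 1) ∧ 1 ≤ g n := by
  induction n with
  | zero => simp [g]
  | succ n ih =>
    have : g (n + 1 + 1) = g n + g (n + 1) := rfl
    omega

theorem g_bounds (n : ℕ) : 2 ≤ g (n + 1) ∧ g (n + 1) < g (n + 2) ∧ g (n + 2) < 2 * g (n + 1) := by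
  have h := two_le_g n
  have h2 : g (n + 2) = g n + g (n + 1) := rfl
  cases n with
  | zero => simp [g]
  | succ n =>
    have := two_le_g n
    have h3 : g (n + 1 + 1) = g n + g (n + 1) := rfl
    omega

/-- The background of the words read by `T n`. -/
def bg (n : ℕ) : Fin 2 := if Even n then 0 else 1

theorem bg_add_two (n : ℕ) : bg (n + 2) = bg n := by
  simp [bg, Nat.even_add]

theorem length_TRead_alpha (n : ℕ) : ((TRead n .alpha).length : ℤ) = g (n + 2) - 3 := by
  have := g_bounds n
  by_cases hn : Even n <;> simp only [TRead, hn, if_true, if_false, List.length_replicate] <;> omega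

theorem length_TRead (n : ℕ) (X : Block) :
    ((TRead n X.edge).length : ℤ) + (g (n + 2) - 3) = X.len (g (n + 1)) (g (n + 2)) := by
  have h : g (n + 3) = g (n + 1) + g (n + 2) := rfl
  by_cases hn : Even n <;> cases X <;>
    simp [TRead, hn, h, Block.edge, Block.len] <;> ring

theorem getElem?_marked {c u v w l : Fin 2} {p q k : ℕ}
    (h : (pow c p ++ [u, v, w] ++ pow c q)[k]? = some l) :
    (k < p → l = c) ∧ (k = p → l = u) ∧ (k = p + 1 → l = v) ∧ (k = p + 2 → l = w) ∧
      (p + 3 ≤ k → l = c) := by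
  simp only [List.getElem?_append, List.getElem?_replicate, List.length_append,
    List.length_replicate] at h
  refine ⟨?_, ?_, ?_, ?_, ?_⟩ <;> intro hk
  · rw [if_pos (by simp; omega), if_pos hk, if_pos hk] at h
    exact (Option.some.inj h).symm
  · subst hk
    simpa [eq_comm] using h
  · subst hk
    simpa [eq_comm] using h
  · subst hk
    simpa [eq_comm] using h
  · rw [if_neg (by simp; omega)] at h
    split_ifs at h
    exact (Option.some.inj h).symm

theorem getElem?_pow {c l : Fin 2} {p k : ℕ} (h : (pow c p)[k]? = some l) : l = c := by
  rw [List.getElem?_replicate] at h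
  split_ifs at h
  exact (Option.some.inj h).symm

theorem ne_iff_of_marked3 {c l d : Fin 2} {p q k : ℕ} (hd : d ≠ c)
    (h : (pow c p ++ [d, d, d] ++ pow c q)[k]? = some l) :
    l ≠ c ↔ (p : ℤ) ≤ k ∧ (k : ℤ) < p + 3 := by
  obtain ⟨h1, h2, h3, h4, h5⟩ := getElem?_marked h
  rcases (by omega : k < p ∨ k = p ∨ k = p + 1 ∨ k = p + 2 ∨ p + 3 ≤ k) with hk | hk | hk | hk | hk
  · simp only [h1 hk, ne_eq, not_true_eq_false, false_iff]; omega
  · simp only [h2 hk, ne_eq, hd, not_false_eq_true, true_iff]; omega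
  · simp only [h3 hk, ne_eq, hd, not_false_eq_true, true_iff]; omega
  · simp only [h4 hk, ne_eq, hd, not_false_eq_true, true_iff]; omega
  · simp only [h5 hk, ne_eq, not_true_eq_false, false_iff]; omega

/-- One statement for `110` on background `0` and `100` on background `1`: the middle letter is dark
in both, together with the first one or the last one respectively. -/
theorem ne_iff_of_marked2 {c l : Fin 2} {p q k : ℕ}
    (h : (pow c p ++ [1, if c = 0 then 1 else 0, 0] ++ pow c q)[k]? = some l) :
    l ≠ c ↔ Dark2 c p k := by
  obtain ⟨h1, h2, h3, h4, h5⟩ := getElem?_marked h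
  obtain rfl | rfl : c = 0 ∨ c = 1 := by omega
  all_goals
    simp only [Dark2, if_true, one_ne_zero, if_false] at h3 ⊢
    rcases (by omega : k < p ∨ k = p ∨ k = p + 1 ∨ k = p + 2 ∨ p + 3 ≤ k) with
      hk | hk | hk | hk | hk
    · simp only [h1 hk, ne_eq, not_true_eq_false, false_iff]; omega
    · simp [h2 hk]; omega
    · simp [h3 hk]; omega
    · simp [h4 hk]; omega
    · simp only [h5 hk, ne_eq, not_true_eq_false, false_iff]; omega

theorem TRead_alpha_letter {n k : ℕ} {l : Fin 2} (h : (TRead n .alpha)[k]? = some l) :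
    l = bg n := by
  by_cases hn : Even n <;> simp only [TRead, bg, hn, if_true, if_false] at h ⊢ <;>
    exact getElem?_pow h

theorem TWrite_alpha_letter {n k : ℕ} {l : Fin 2} (h : (TWrite n .alpha)[k]? = some l) :
    l = bg (n + 1) := by
  by_cases hn : Even n <;> simp only [TWrite, bg, hn, Nat.even_add_one, not_true_eq_false,
    not_false_eq_true, if_true, if_false] at h ⊢ <;> exact getElem?_pow h

theorem TRead_letter {n k : ℕ} {l : Fin 2} (X : Block) (h : (TRead n X.edge)[k]? = some l) :
    l ≠ bg n ↔ X.InDark (g (n + 1)) (g (n + 2)) (bg n) k := by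
  have h3 : ((g (n + 1) : ℕ) : ℤ) + (g (n + 2) : ℕ) = (g (n + 3) : ℕ) := by
    rw [show g (n + 3) = g (n + 1) + g (n + 2) from rfl]; push_cast; ring
  by_cases hn : Even n <;> cases X <;>
    simp only [TRead, bg, hn, if_true, if_false, Block.edge, Block.InDark, iff_false, ne_eq,
      not_not, h3] at h ⊢
  · exact getElem?_pow h
  · exact getElem?_pow h
  · exact ne_iff_of_marked3 (by decide) h
  · exact ne_iff_of_marked2 (q := 0) (by simpa using h)
  · exact ne_iff_of_marked2 h
  · exact getElem?_pow h
  · exact getElem?_pow h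
  · exact ne_iff_of_marked3 (by decide) h
  · exact ne_iff_of_marked2 (q := 0) (by simpa using h)
  · exact ne_iff_of_marked2 h

theorem TWrite_letter {n k : ℕ} {l : Fin 2} (X : Block) (h : (TWrite n X.edge)[k]? = some l) :
    l ≠ bg (n + 1) ↔ X.OutDark (g (n + 1)) (g (n + 2)) (bg (n + 1)) k := by
  by_cases hn : Even n <;> cases X <;>
    simp only [TWrite, bg, hn, Nat.even_add_one, not_true_eq_false, not_false_eq_true, if_true,
      if_false, Block.edge, Block.OutDark, iff_false, ne_eq, not_not] at h ⊢
  · exact ne_iff_of_marked2 (p := 0) (by simpa using h)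
  · exact ne_iff_of_marked3 (by decide) h
  · exact getElem?_pow h
  · exact getElem?_pow h
  · exact ne_iff_of_marked2 h
  · exact ne_iff_of_marked2 (p := 0) (by simpa using h)
  · exact ne_iff_of_marked3 (by decide) h
  · exact getElem?_pow h
  · exact getElem?_pow h
  · exact ne_iff_of_marked2 h

/-! ### Runs of `T n` and tilings -/

/-- The length of the transition `e` of `T n`. -/
def TLen (n : ℕ) (e : TEdge) : ℕ := (TRead n e).length

/-- The letter of index `k'` of `e'` may follow the letter of index `k` of `e` in a run of `T n`. -/
def Succ (n : ℕ) (e : TEdge) (k : ℕ) (e' : TEdge) (k' : ℕ) : Prop :=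
  e = e' ∧ k' = k + 1 ∨ k + 1 = TLen n e ∧ k' = 0 ∧
    (e = .alpha ∧ e' ≠ .alpha ∨ e ≠ .alpha ∧ e' = .alpha ∨
      e ≠ .alpha ∧ e' ≠ .alpha ∧ TLen n .alpha = 0)

theorem TLen_block_pos (n : ℕ) {e : TEdge} (he : e ≠ .alpha) : 0 < TLen n e := by
  obtain ⟨X, rfl⟩ := TEdge.exists_block he
  have := g_bounds n
  have h := length_TRead n X
  have := X.le_len (a := g (n + 1)) (b := g (n + 2)) (by omega) (by omega)
  simp only [TLen]
  omega

/-- Only `alpha` can be empty, which happens for `n = 0` because `g 2 = 3`; then one block may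
directly follow another. -/
theorem emptyReach_iff (n : ℕ) (e e' : TEdge) :
    (TCompact n).EmptyReach ((TCompact n).tgt e) ((TCompact n).src e') ↔
      (e = .alpha ∧ e' ≠ .alpha ∨ e ≠ .alpha ∧ e' = .alpha ∨
      e ≠ .alpha ∧ e' ≠ .alpha ∧ TLen n .alpha = 0) := by
  have step : ∀ p q : Fin 2, (TCompact n).EmptyReach p q →
      p = q ∨ p = 0 ∧ q = 1 ∧ TLen n .alpha = 0 := by
    intro p q h
    rcases Relation.ReflTransGen.cases_head h with h | ⟨r, ⟨f, hf, -, hr⟩, -⟩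
    · exact Or.inl h
    · have hfα : f = .alpha := by
        by_contra hne
        have := TLen_block_pos n hne
        have hr : TRead n f = [] := hr
        simp [TLen, hr] at this
      subst hfα
      have hp : p = 0 := hf.symm
      have hr : TRead n .alpha = [] := hr
      by_cases hq : p = q
      · exact Or.inl hq
      · exact Or.inr ⟨hp, by omega, by simp [TLen, hr]⟩
  constructor
  · intro h
    have h := step _ _ h
    simp only [TCompact] at h
    by_cases h1 : e = .alpha <;> by_cases h2 : e' = .alpha <;> simp [h1, h2] at h ⊢
    exact h
  · have e0 : ∀ p q : Fin 2, p = q → (TCompact n).EmptyReach p q := by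
      rintro p q rfl
      exact Relation.ReflTransGen.refl
    rintro (⟨h1, h2⟩ | ⟨h1, h2⟩ | ⟨h1, h2, h3⟩)
    · exact e0 _ _ (by simp [TCompact, h1, h2])
    · exact e0 _ _ (by simp [TCompact, h1, h2])
    · refine Relation.ReflTransGen.single ⟨.alpha, ?_, ?_, List.length_eq_zero_iff.1 h3⟩
      · simp [TCompact, h1]
      · simp [TCompact, h2]

theorem T_rel_iff (n : ℕ) (x y : ℤ → Fin 2) :
    (T n).Rel x y ↔ ∃ (e : ℤ → TEdge) (k : ℤ → ℕ), ∀ i,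
      (TRead n (e i))[k i]? = some (x i) ∧ (TWrite n (e i))[k i]? = some (y i) ∧
      Succ n (e i) (k i) (e (i + 1)) (k (i + 1)) := by
  constructor
  · rintro ⟨h, hh⟩
    change ℤ → (TCompact n).Position at h
    refine ⟨fun i => (h i).1, fun i => (h i).2, fun i => ?_⟩
    obtain ⟨p, q, hpq, heq⟩ := hh i
    obtain rfl : h i = p := congrArg (fun t => t.1) heq
    obtain rfl : h (i + 1) = q := congrArg (fun t => t.2.1) heq
    have hx := congrArg (fun t => t.2.2.1) heq
    have hy := congrArg (fun t => t.2.2.2) heq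
    refine ⟨?_, ?_, ?_⟩
    · exact (List.getElem?_eq_getElem (h i).2.2).trans (congrArg some hx.symm)
    · exact (List.getElem?_eq_getElem _).trans (congrArg some hy.symm)
    · rcases hpq with ⟨h1, h2⟩ | ⟨h1, h2, h3⟩
      · exact Or.inl ⟨h1, h2⟩
      · exact Or.inr ⟨h1, h2, (emptyReach_iff n _ _).1 h3⟩
  · rintro ⟨e, k, h⟩
    have hk : ∀ i, k i < (TRead n (e i)).length := fun i =>
      (List.getElem?_eq_some_iff.1 (h i).1).1
    refine ⟨fun i => (⟨e i, ⟨k i, hk i⟩⟩ : (TCompact n).Position), fun i => ?_⟩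
    refine ⟨⟨e i, ⟨k i, hk i⟩⟩, ⟨e (i + 1), ⟨k (i + 1), hk (i + 1)⟩⟩, ?_, ?_⟩
    · rcases (h i).2.2 with ⟨h1, h2⟩ | ⟨h1, h2, h3⟩
      · exact Or.inl ⟨h1, h2⟩
      · exact Or.inr ⟨h1, h2, (emptyReach_iff n _ _).2 h3⟩
    · obtain ⟨h1, h2, -⟩ := h i
      exact Prod.ext rfl (Prod.ext rfl (Prod.ext (List.getElem?_eq_some_iff.1 h1).2.symm
        (List.getElem?_eq_some_iff.1 h2).2.symm))

section

variable {n : ℕ} {e : ℤ → TEdge} {k : ℤ → ℕ} {X : Block} {i p : ℤ}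

/-- A block is placed at `p` when its transition begins at `p - 3`. -/
def Starts (e : ℤ → TEdge) (k : ℤ → ℕ) (X : Block) (p : ℤ) : Prop :=
  e (p - 3) = X.edge ∧ k (p - 3) = 0

theorem run_advance (hs : ∀ i, Succ n (e i) (k i) (e (i + 1)) (k (i + 1))) (h0 : k i = 0) (m : ℕ)
    (hm : m < TLen n (e i)) : e (i + m) = e i ∧ k (i + m) = m := by
  induction m with
  | zero => simp [h0]
  | succ m ih =>
    obtain ⟨h1, h2⟩ := ih (by omega)
    have h3 := hs (i + m)
    rw [show i + ((m + 1 : ℕ) : ℤ) = i + m + 1 by push_cast; ring]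
    rcases h3 with ⟨h3, h4⟩ | ⟨h3, -⟩
    · exact ⟨h3 ▸ h1, by omega⟩
    · rw [h1] at h3
      omega

/-- The state of a run inside a block, after its `m` first letters. -/
theorem run_block (hk : ∀ i, k i < TLen n (e i))
    (hs : ∀ i, Succ n (e i) (k i) (e (i + 1)) (k (i + 1))) (hX : Starts e k X p) :
    (∀ m : ℕ, m < TLen n X.edge → e (p - 3 + m) = X.edge ∧ k (p - 3 + m) = m) ∧
    (∀ m : ℕ, m < TLen n .alpha → e (p - 3 + TLen n X.edge + m) = .alpha ∧
      k (p - 3 + TLen n X.edge + m) = m) ∧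
    ∃ Y, Starts e k Y (p + TLen n X.edge + TLen n .alpha) := by
  have hpos := TLen_block_pos n X.edge_ne
  have h1 : ∀ m : ℕ, m < TLen n X.edge → e (p - 3 + m) = X.edge ∧ k (p - 3 + m) = m := by
    intro m hm
    rw [← hX.1]
    exact run_advance hs hX.2 m (by rwa [hX.1])
  have last := h1 (TLen n X.edge - 1) (by omega)
  have hl := hs (p - 3 + (TLen n X.edge - 1 : ℕ))
  rw [show p - 3 + ((TLen n X.edge - 1 : ℕ) : ℤ) + 1 = p - 3 + TLen n X.edge by omega] at hl
  rw [last.1, last.2] at hl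
  rcases hl with ⟨h, h'⟩ | ⟨-, h0, ⟨h, -⟩ | ⟨-, h⟩ | ⟨-, h, hα⟩⟩
  · have := hk (p - 3 + TLen n X.edge)
    rw [← h] at this
    omega
  · exact (X.edge_ne h).elim
  · have h2 : ∀ m : ℕ, m < TLen n .alpha → e (p - 3 + TLen n X.edge + m) = .alpha ∧
        k (p - 3 + TLen n X.edge + m) = m := by
      intro m hm
      rw [← h] at hm ⊢
      exact run_advance hs h0 m hm
    refine ⟨h1, h2, ?_⟩
    have hα := hk (p - 3 + TLen n X.edge)
    rw [h] at hα
    have last := h2 (TLen n .alpha - 1) (by omega)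
    have hl := hs (p - 3 + TLen n X.edge + (TLen n .alpha - 1 : ℕ))
    rw [show p - 3 + TLen n X.edge + ((TLen n .alpha - 1 : ℕ) : ℤ) + 1 =
      p + TLen n X.edge + TLen n .alpha - 3 by omega] at hl
    rw [last.1, last.2] at hl
    rcases hl with ⟨h, h'⟩ | ⟨-, h0, ⟨-, h⟩ | ⟨h, -⟩ | ⟨h, -⟩⟩
    · have := hk (p + TLen n X.edge + TLen n .alpha - 3)
      rw [← h] at this
      omega
    · obtain ⟨Y, hY⟩ := TEdge.exists_block h
      exact ⟨Y, hY.symm, h0⟩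
    · exact (h rfl).elim
    · exact (h rfl).elim
  · refine ⟨h1, fun m hm => by omega, ?_⟩
    obtain ⟨Y, hY⟩ := TEdge.exists_block h
    refine ⟨Y, ?_⟩
    rw [Starts, show p + TLen n X.edge + TLen n .alpha - 3 = p - 3 + TLen n X.edge by omega]
    exact ⟨hY.symm, h0⟩

theorem run_begin (hs : ∀ i, Succ n (e i) (k i) (e (i + 1)) (k (i + 1))) (i : ℤ) :
    ∃ j ≤ i, e j = e i ∧ k j = 0 := by
  generalize hm : k i = m
  induction m generalizing i with
  | zero => exact ⟨i, le_rfl, rfl, hm⟩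
  | succ m ih =>
    have h := hs (i - 1)
    rw [sub_add_cancel] at h
    rcases h with ⟨h, h'⟩ | ⟨-, h, -⟩
    · obtain ⟨j, hj, h1, h2⟩ := ih (i - 1) (by omega)
      exact ⟨j, by omega, h1.trans h, h2⟩
    · omega

theorem run_begin_block (hs : ∀ i, Succ n (e i) (k i) (e (i + 1)) (k (i + 1))) (i : ℤ) :
    ∃ j ≤ i, e j ≠ .alpha ∧ k j = 0 := by
  obtain ⟨j, hj, h1, h2⟩ := run_begin hs i
  by_cases hα : e j = .alpha
  · have h := hs (j - 1)
    rw [sub_add_cancel] at h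
    rcases h with ⟨h, h'⟩ | ⟨-, -, ⟨-, h⟩ | ⟨h, -⟩ | ⟨h, -⟩⟩
    · omega
    · exact (h hα).elim
    all_goals
      obtain ⟨r, hr, h3, h4⟩ := run_begin hs (j - 1)
      exact ⟨r, by omega, h3 ▸ h, h4⟩
  · exact ⟨j, hj, hα, h2⟩

theorem len_eq_TLen (n : ℕ) (X : Block) :
    X.len (g (n + 1)) (g (n + 2)) = TLen n X.edge + TLen n .alpha := by
  rw [← length_TRead, TLen, TLen, length_TRead_alpha]

theorem run_tiling (hk : ∀ i, k i < TLen n (e i))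
    (hs : ∀ i, Succ n (e i) (k i) (e (i + 1)) (k (i + 1))) :
    Tiling (g (n + 1)) (g (n + 2)) (Starts e k) where
  next := by
    intro X p hX
    obtain ⟨-, -, Y, hY⟩ := run_block hk hs hX
    exact ⟨Y, by rwa [len_eq_TLen, ← add_assoc]⟩
  disj := by
    intro X Y p q hX hY hpq hq
    rw [len_eq_TLen] at hq
    obtain ⟨h1, h2, -⟩ := run_block hk hs hX
    by_cases hlt : q < p + TLen n X.edge
    · obtain ⟨h3, h4⟩ := h1 (q - p).toNat (by omega)
      rw [show p - 3 + ((q - p).toNat : ℤ) = q - 3 by omega] at h3 h4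
      rw [hY.1] at h3
      rw [hY.2] at h4
      exact ⟨by omega, (Block.edge_injective h3).symm⟩
    · obtain ⟨h3, -⟩ := h2 (q - p - TLen n X.edge).toNat (by omega)
      rw [show p - 3 + TLen n X.edge + ((q - p - TLen n X.edge).toNat : ℤ) = q - 3 by omega,
        hY.1] at h3
      exact (Y.edge_ne h3).elim
  below := by
    intro p
    obtain ⟨j, hj, h1, h2⟩ := run_begin_block hs (p - 3)
    obtain ⟨X, hX⟩ := TEdge.exists_block h1
    exact ⟨j + 3, by omega, X, by rw [Starts, add_sub_cancel_right]; exact ⟨hX.symm, h2⟩⟩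

end

/-- These indices, from the last `b - 3` letters of the block onwards, cover its `alpha` part. -/
theorem Block.not_inDark {a b k : ℤ} (ha : 2 ≤ a) (hb : 3 ≤ b) (c : Fin 2) (X : Block)
    (h : X.len a b ≤ k + (b - 3)) : ¬ X.InDark a b c k := by
  cases X <;> simp only [Block.len, Block.InDark, Dark2, not_false_eq_true] at h ⊢ <;>
    (try split_ifs) <;> omega

theorem Block.not_outDark {a b k : ℤ} (ha : 2 ≤ a) (hb : 3 ≤ b) (c : Fin 2) (X : Block)
    (h : X.len a b ≤ k + (b - 3)) : ¬ X.OutDark a b c k := by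
  cases X <;> simp only [Block.len, Block.OutDark, Dark2, not_false_eq_true] at h ⊢ <;>
    (try split_ifs) <;> omega

theorem eq_of_ne_iff {c l x : Fin 2} (h : l ≠ c ↔ x ≠ c) : l = x := by
  by_cases hl : l = c
  · have : x = c := by
      by_contra hx
      exact h.2 hx hl
    rw [hl, this]
  · have := h.1 hl
    omega

section

variable {n : ℕ} {x y : ℤ → Fin 2}

theorem exists_tiling_of_rel (h : (T n).Rel x y) :
    ∃ S, Tiling (g (n + 1)) (g (n + 2)) S ∧
      Ink (bg n) (in2 (g (n + 1)) (g (n + 2)) S) (in3 (g (n + 1)) S) x ∧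
      Ink (bg (n + 1)) (out2 (g (n + 1)) S) (out3 (g (n + 2)) S) y := by
  obtain ⟨e, k, h⟩ := (T_rel_iff n x y).1 h
  have hk : ∀ i, k i < TLen n (e i) := fun i => (List.getElem?_eq_some_iff.1 (h i).1).1
  have hs := fun i => (h i).2.2
  have ht := run_tiling hk hs
  have hg := g_bounds n
  have ha : (2 : ℤ) ≤ g (n + 1) := by omega
  have hb : (3 : ℤ) ≤ g (n + 2) := by omega
  have key : ∀ q, ∃ X p, Starts e k X p ∧ p ≤ q + 3 ∧
      q + 3 < p + X.len (g (n + 1)) (g (n + 2)) ∧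
      (e q = X.edge ∧ (k q : ℤ) = q + 3 - p ∨
        e q = .alpha ∧ X.len (g (n + 1)) (g (n + 2)) ≤ q + 3 - p + (g (n + 2) - 3)) := by
    intro q
    obtain ⟨X, p, hX, h1, h2⟩ := ht.cover (by omega) (by omega) (q + 3)
    refine ⟨X, p, hX, h1, h2, ?_⟩
    obtain ⟨h3, h4, -⟩ := run_block hk hs hX
    have hα := length_TRead_alpha n
    change (TLen n .alpha : ℤ) = _ at hα
    rw [len_eq_TLen] at h2 ⊢
    by_cases hlt : q + 3 < p + TLen n X.edge
    · obtain ⟨h5, h6⟩ := h3 (q + 3 - p).toNat (by omega)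
      rw [show p - 3 + ((q + 3 - p).toNat : ℤ) = q by omega] at h5 h6
      exact Or.inl ⟨h5, by omega⟩
    · obtain ⟨h5, -⟩ := h4 (q + 3 - p - TLen n X.edge).toNat (by omega)
      rw [show p - 3 + TLen n X.edge + ((q + 3 - p - TLen n X.edge).toNat : ℤ) = q by omega] at h5
      exact Or.inr ⟨h5, by omega⟩
  refine ⟨_, ht, fun q => ?_, fun q => ?_⟩
  · obtain ⟨X, p, hX, h1, h2, ⟨h3, h4⟩ | ⟨h3, h4⟩⟩ := key q
    · rw [ht.dark_in_iff ha hb _ hX h1 h2, ← h4]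
      exact TRead_letter X (h3 ▸ (h q).1)
    · rw [ht.dark_in_iff ha hb _ hX h1 h2]
      exact iff_of_false (not_not.2 (TRead_alpha_letter (h3 ▸ (h q).1)))
        (X.not_inDark ha hb _ h4)
  · obtain ⟨X, p, hX, h1, h2, ⟨h3, h4⟩ | ⟨h3, h4⟩⟩ := key q
    · rw [ht.dark_out_iff ha hb _ hX h1 h2, ← h4]
      exact TWrite_letter X (h3 ▸ (h q).2.1)
    · rw [ht.dark_out_iff ha hb _ hX h1 h2]
      exact iff_of_false (not_not.2 (TWrite_alpha_letter (h3 ▸ (h q).2.1)))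
        (X.not_outDark ha hb _ h4)

theorem rel_of_tiling {S : Block → ℤ → Prop} (ht : Tiling (g (n + 1)) (g (n + 2)) S)
    (hx : Ink (bg n) (in2 (g (n + 1)) (g (n + 2)) S) (in3 (g (n + 1)) S) x)
    (hy : Ink (bg (n + 1)) (out2 (g (n + 1)) S) (out3 (g (n + 2)) S) y) : (T n).Rel x y := by
  classical
  have hg := g_bounds n
  have ha : (2 : ℤ) ≤ g (n + 1) := by omega
  have hb : (3 : ℤ) ≤ g (n + 2) := by omega
  have hα := length_TRead_alpha n
  change (TLen n .alpha : ℤ) = _ at hα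
  choose X p hX h1 h2 using fun i : ℤ => ht.cover (by omega) (by omega) (i + 3)
  have huniq : ∀ i {Y r}, S Y r → r ≤ i + 3 → i + 3 < r + Y.len (g (n + 1)) (g (n + 2)) →
      X i = Y ∧ p i = r := by
    intro i Y r hY hr hr'
    have h3 := h1 i
    have h4 := h2 i
    rcases ht.sep (hX i) hY with ⟨h, h'⟩ | h | h
    · exact ⟨h', h⟩
    · omega
    · omega
  have hnext : ∀ i, X (i + 1) = X i ∧ p (i + 1) = p i ∨
      i + 4 = p i + (X i).len (g (n + 1)) (g (n + 2)) ∧ p (i + 1) = i + 4 := by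
    intro i
    have h3 := h1 i
    have h4 := h2 i
    by_cases hlt : i + 4 < p i + (X i).len (g (n + 1)) (g (n + 2))
    · exact Or.inl (huniq (i + 1) (hX i) (by omega) (by omega))
    · obtain ⟨Y, hY⟩ := ht.next (hX i)
      have := Y.le_len (a := g (n + 1)) (b := g (n + 2)) (by omega) (by omega)
      exact Or.inr ⟨by omega, by rw [(huniq (i + 1) hY (by omega) (by omega)).2]; omega⟩
  -- The run is read off the covering block: its own transition first, then `alpha` for the
  -- remaining letters.
  let e : ℤ → TEdge := fun i => if i + 3 < p i + TLen n (X i).edge then (X i).edge else .alpha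
  let k : ℤ → ℕ := fun i => if i + 3 < p i + TLen n (X i).edge then (i + 3 - p i).toNat
    else (i + 3 - p i - TLen n (X i).edge).toNat
  have hstate : ∀ i, i + 3 < p i + TLen n (X i).edge ∧ e i = (X i).edge ∧ (k i : ℤ) = i + 3 - p i ∨
      p i + TLen n (X i).edge ≤ i + 3 ∧ e i = .alpha ∧
        (k i : ℤ) = i + 3 - p i - TLen n (X i).edge := by
    intro i
    have h3 := h1 i
    by_cases hlt : i + 3 < p i + TLen n (X i).edge
    · left
      simp only [e, k, if_pos hlt, true_and, hlt]
      omega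
    · right
      simp only [e, k, if_neg hlt, true_and]
      omega
  have hk : ∀ i, k i < (TRead n (e i)).length := by
    intro i
    have h4 := h2 i
    rw [len_eq_TLen] at h4
    rcases hstate i with ⟨h5, h6, h7⟩ | ⟨h5, h6, h7⟩ <;> rw [h6] <;> simp only [TLen] at * <;> omega
  refine (T_rel_iff n x y).2 ⟨e, k, fun i => ⟨?_, ?_, ?_⟩⟩
  · obtain ⟨l, hl⟩ : ∃ l, (TRead n (e i))[k i]? = some l := ⟨_, List.getElem?_eq_getElem (hk i)⟩
    rw [hl, Option.some_inj]
    refine eq_of_ne_iff (c := bg n) ?_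
    rw [hx i, ht.dark_in_iff ha hb _ (hX i) (h1 i) (h2 i)]
    rcases hstate i with ⟨h5, h6, h7⟩ | ⟨h5, h6, h7⟩ <;> rw [h6] at hl
    · rw [← h7]
      exact TRead_letter _ hl
    · refine iff_of_false (not_not.2 (TRead_alpha_letter hl)) ((X i).not_inDark ha hb _ ?_)
      rw [len_eq_TLen]
      omega
  · have hk' : k i < (TWrite n (e i)).length := TRead_length_eq n (e i) ▸ hk i
    obtain ⟨l, hl⟩ : ∃ l, (TWrite n (e i))[k i]? = some l := ⟨_, List.getElem?_eq_getElem hk'⟩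
    rw [hl, Option.some_inj]
    refine eq_of_ne_iff (c := bg (n + 1)) ?_
    rw [hy i, ht.dark_out_iff ha hb _ (hX i) (h1 i) (h2 i)]
    rcases hstate i with ⟨h5, h6, h7⟩ | ⟨h5, h6, h7⟩ <;> rw [h6] at hl
    · rw [← h7]
      exact TWrite_letter _ hl
    · refine iff_of_false (not_not.2 (TWrite_alpha_letter hl)) ((X i).not_outDark ha hb _ ?_)
      rw [len_eq_TLen]
      omega
  · have hp := TLen_block_pos n (X i).edge_ne
    have hp' := TLen_block_pos n (X (i + 1)).edge_ne
    have h4 := h2 i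
    have hn := hnext i
    rw [len_eq_TLen] at h4 hn
    have hs := hstate i
    have hs' := hstate (i + 1)
    have he := (X i).edge_ne
    have he' := (X (i + 1)).edge_ne
    rcases hn with ⟨h5, h6⟩ | ⟨h5, h6⟩
    · rw [h5, h6] at hs'
      rcases hs with ⟨h7, h8, h9⟩ | ⟨h7, h8, h9⟩ <;>
        rcases hs' with ⟨h10, h11, h12⟩ | ⟨h10, h11, h12⟩
      · exact Or.inl ⟨h8.trans h11.symm, by omega⟩
      · refine Or.inr ⟨by rw [h8]; omega, by omega, Or.inr (Or.inl ⟨h8 ▸ he, h11⟩)⟩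
      · omega
      · exact Or.inl ⟨h8.trans h11.symm, by omega⟩
    · rw [h6] at hs'
      rcases hs' with ⟨h10, h11, h12⟩ | ⟨h10, h11, h12⟩
      · rcases hs with ⟨h7, h8, h9⟩ | ⟨h7, h8, h9⟩
        · exact Or.inr ⟨by rw [h8]; omega, by omega,
            Or.inr (Or.inr ⟨h8 ▸ he, h11 ▸ he', by omega⟩)⟩
        · exact Or.inr ⟨by rw [h8]; omega, by omega, Or.inl ⟨h8, h11 ▸ he'⟩⟩
      · omega

theorem T_rel_iff_tiling : (T n).Rel x y ↔
    ∃ S, Tiling (g (n + 1)) (g (n + 2)) S ∧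
      Ink (bg n) (in2 (g (n + 1)) (g (n + 2)) S) (in3 (g (n + 1)) S) x ∧
      Ink (bg (n + 1)) (out2 (g (n + 1)) S) (out3 (g (n + 2)) S) y :=
  ⟨exists_tiling_of_rel, fun ⟨_, h, hx, hy⟩ => rel_of_tiling h hx hy⟩

end

/-! ### Composition and the theorem -/

theorem WangSet.comp_rel_iff {V : Type} (A B : WangSet V) (x z : ℤ → V) :
    (A.comp B).Rel x z ↔ ∃ y, A.Rel x y ∧ B.Rel y z := by
  constructor
  · rintro ⟨h, hh⟩
    choose w e w' e' s m m' h1 h2 h3 using hh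
    refine ⟨m, ⟨fun i => (h i).1, fun i => ?_⟩, ⟨fun i => (h i).2, fun i => ?_⟩⟩
    · obtain ⟨h4, h5, h6, h7⟩ :
        h i = (w i, w' i) ∧ h (i + 1) = (e i, e' i) ∧ x i = s i ∧ z i = m' i := by
        have h := h3 i
        exact ⟨congrArg (·.1) h, congrArg (·.2.1) h, congrArg (·.2.2.1) h, congrArg (·.2.2.2) h⟩
      have := h1 i
      rwa [← h6, show w i = (h i).1 by rw [h4], show e i = (h (i + 1)).1 by rw [h5]] at this
    · obtain ⟨h4, h5, h6, h7⟩ :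
        h i = (w i, w' i) ∧ h (i + 1) = (e i, e' i) ∧ x i = s i ∧ z i = m' i := by
        have h := h3 i
        exact ⟨congrArg (·.1) h, congrArg (·.2.1) h, congrArg (·.2.2.1) h, congrArg (·.2.2.2) h⟩
      have := h2 i
      rwa [← h7, show w' i = (h i).2 by rw [h4], show e' i = (h (i + 1)).2 by rw [h5]] at this
  · rintro ⟨y, ⟨h, hh⟩, ⟨h', hh'⟩⟩
    exact ⟨fun i => (h i, h' i), fun i => ⟨_, _, _, _, _, _, _, hh i, hh' i, rfl⟩⟩

theorem mainTheorem6 (n : ℕ) :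
    WangSet.Equivalent (T (n + 3)) (((T (n + 1)).comp (T n)).comp (T (n + 1))) := by
  intro x w
  have hg := g_bounds n
  have hg' := g_bounds (n + 1)
  have e3 : (g (n + 3) : ℤ) = g (n + 1) + g (n + 2) := by
    rw [show g (n + 3) = g (n + 1) + g (n + 2) from rfl]; push_cast; rfl
  have e4 : (g (n + 4) : ℤ) = g (n + 1) + 2 * g (n + 2) := by
    rw [show g (n + 4) = g (n + 2) + g (n + 3) from rfl]; push_cast; rw [e3]; ring
  have e5 : (g (n + 5) : ℤ) = 2 * g (n + 1) + 3 * g (n + 2) := by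
    rw [show g (n + 5) = g (n + 3) + g (n + 4) from rfl]; push_cast; rw [e3, e4]; ring
  have h1 := @T_rel_iff_tiling (n + 1)
  have h3 := @T_rel_iff_tiling (n + 3)
  rw [show bg (n + 1 + 1) = bg n from bg_add_two n, show n + 1 + 1 = n + 2 from rfl,
    show n + 1 + 2 = n + 3 from rfl, e3] at h1
  rw [show bg (n + 3) = bg (n + 1) from bg_add_two (n + 1),
    show bg (n + 3 + 1) = bg n by rw [show n + 3 + 1 = n + 2 + 2 from rfl, bg_add_two, bg_add_two],
    show n + 3 + 1 = n + 4 from rfl, show n + 3 + 2 = n + 5 from rfl, e4, e5] at h3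
  simp only [WangSet.comp_rel_iff, h1, h3, @T_rel_iff_tiling n]
  constructor
  · rintro ⟨S, hS, hx, hw⟩
    obtain ⟨U, M, L, s, hU2, hU3, hL2, hL3⟩ := exists_stack (by omega) (by omega) (by omega) hS
    -- The intermediate words are drawn from the marks of the second layer; the outer layers fit
    -- them because the marks agree.
    obtain ⟨y, hy⟩ := exists_ink (bg n) (in2 (g (n + 1)) (g (n + 2)) M) (in3 (g (n + 1)) M)
    obtain ⟨z, hz⟩ := exists_ink (bg (n + 1)) (out2 (g (n + 1)) M) (out3 (g (n + 2)) M)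
    refine ⟨z, ⟨y, ⟨U, s.tU, ?_, ?_⟩, ⟨M, s.tM, hy, hz⟩⟩, ⟨L, s.tL, ?_, ?_⟩⟩
    · rwa [hU2, hU3]
    · rwa [funext fun p => propext (s.y2 p), funext fun p => propext (s.y3 p)]
    · rwa [← funext fun p => propext (s.z2 p), ← funext fun p => propext (s.z3 p)]
    · rwa [hL2, hL3]
  · rintro ⟨z, ⟨y, ⟨U, hU, hx, hy⟩, ⟨M, hM, hy', hz⟩⟩, ⟨L, hL, hz', hw⟩⟩
    -- A word shared by two layers determines its marks, so the three runs form a stack.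
    obtain ⟨y2, y3⟩ := hy.marks_eq hy' (hU.sparse_out (by omega) (by omega))
      (hM.sparse_in (by omega) (by omega))
    obtain ⟨z2, z3⟩ := hz.marks_eq hz' (hM.sparse_out (by omega) (by omega))
      (hL.sparse_in (by omega) (by omega))
    have s : Stack (g (n + 1)) (g (n + 2)) U M L := {
      pos := by omega
      lt := by omega
      lt_two := by omega
      tU := hU
      tM := hM
      tL := hL
      y2 := fun p => by rw [y2]
      y3 := fun p => by rw [y3]
      z2 := fun p => by rw [z2]
      z3 := fun p => by rw [z3] }
    obtain ⟨S, hS, hU2, hU3, hL2, hL3⟩ := s.exists_merged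
    exact ⟨S, hS, by rwa [hU2, hU3], by rwa [hL2, hL3]⟩
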